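/- \textbf{Effective conditional universality.} Let $\mathbb{X}$ be a finite alphabet with $D\ge 2$ letters. Measures are probability measures on the space $\mathbb{X}^{\mathbb{Z}}$ of two-sided sequences with the product $\sigma$-algebra, $X_k$ are the coordinates, $P(x_1^n)=P(X_1^n=x_1^n)$, $P(a|x_1^n)=P(X_{n+1}=a|X_1^n=x_1^n)$, $\log$ is the binary and $\ln$ the natural logarithm. For a stationary measure $P$ let $h_P=\lim_{n\to\infty}\frac1n\int[-\log P(X_1^n)]\,dP$ be its entropy rate. For $\sigma,\tau\in\mathbb{X}^*$ let $[\sigma,\tau]=\{x: x_{-|\sigma|+1}^{|\tau|}=\sigma\tau\}$. A real function is computable if rational approximations of its values to any prescribed precision can be computed uniformly in its arguments, where an argument from $\mathbb{X}^{\mathbb{Z}}$ is given as an oracle. A measure $R$ is computable if $(\sigma,\tau)\mapsto R([\sigma,\tau])$ is computable. A sequence $s\in\mathbb{X}^{\mathbb{Z}}$ is a representation of a measure $P$ if $P=\rho(s)$ for some (total) map $\rho$ from $\mathbb{X}^{\mathbb{Z}}$ to probability measures such that $(\sigma,\tau,s)\mapsto\rho(s)([\sigma,\tau])$ is computable. A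 Martin-L\"of $(s,P)$-test is a sequence of events $U_n=\bigcup_{(\sigma,\tau)\in V_n}[\sigma,\tau]$ with $P(U_n)\le 2^{-n}$, where the sets $V_n\subset\mathbb{X}^*\times\mathbb{X}^*$ are uniformly computably enumerable with oracle $s$. A point $x$ is $1$-$P$-random (Martin-L\"of $P$-random) if for some representation $s$ of $P$ it lies outside $\bigcap_n U_n$ for every Martin-L\"of $(s,P)$-test $(U_n)$. A measure $R$ (not necessarily stationary) is $1$-universal if it is computable and for every stationary ergodic measure $P$ we have $\lim_{n\to\infty}\frac1n[-\log R(X_1^n)]=h_P$ on all $1$-$P$-random points. Let $R$ be a $1$-universal measure such that for some real sequence $\epsilon_n\to 0$, $$-\log R(x_{n+1}|x_1^n)\le\epsilon_n\sqrt{n/\ln n}\qquad\text{for all } n\ge 2 \text{ and all } x_1^{n+1}\in\mathbb{X}^{n+1}$$ (in particular, these conditional probabilities are positive). Then for every stationary ergodic probability measure $P$, on all $1$-$P$-random points we have $P(X_1^i)>0$ for all $i$ and $$\lim_{n\to\infty}\frac1n\sum_{i=0}^{n-1}\left[-\sum_{a\in\mathbb{X}}P(a|X_1^i)\log R(a|X_1^i)\right]=h_P.$$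 -/

import Mathlib

open MeasureTheory Filter Topology

noncomputable section

namespace AlgRandom

variable {D : ℕ}

/-- Two-sided infinite sequences over the alphabet `{0, …, D - 1}`, with the product σ-algebra. -/
abbrev Seq (D : ℕ) : Type := ℤ → Fin D

/-- Finite strings over the alphabet. -/
abbrev Str (D : ℕ) : Type := List (Fin D)

/-- The string `x_j x_{j+1} … x_{j+n-1}`. In particular `word x 1 n` is `x_1^n`. -/
def word (x : Seq D) (j : ℤ) (n : ℕ) : Str D :=
  (List.range n).map fun i : ℕ => x (j + (i : ℤ))

/-- The cylinder set `(X_{-|σ|+1}^{|τ|} = στ)`. -/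
def cylinder (σ τ : Str D) : Set (Seq D) :=
  {x | word x (-(σ.length : ℤ) + 1) (σ.length + τ.length) = σ ++ τ}

/-- The shift `T`. -/
def shift (x : Seq D) : Seq D := fun i => x (i + 1)

/-- A stationary ergodic probability measure. -/
def IsStationaryErgodic (P : Measure (Seq D)) : Prop :=
  IsProbabilityMeasure P ∧ Ergodic shift P

/-- `P(w) = P(X_1^n = w)`, where `n` is the length of `w`. -/
def prob (P : Measure (Seq D)) (w : Str D) : ℝ :=
  P.real {x | word x 1 w.length = w}

/-- `P(a | w) = P(X_{n+1} = a | X_1^n = w)`, where `n` is the length of `w`. -/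
def condProb (P : Measure (Seq D)) (w : Str D) (a : Fin D) : ℝ :=
  prob P (w ++ [a]) / prob P w

/-- The entropy rate `h_P = lim_n E[-log P(X_1^n)] / n`, in bits. -/
def entropyRate (P : Measure (Seq D)) : ℝ :=
  limUnder atTop fun n : ℕ => (∫ x, -Real.logb 2 (prob P (word x 1 n)) ∂P) / (n : ℝ)

/-- The rational number coded by a triple: `(a, b, c)` codes `(a - b) / (c + 1)`. -/
def ratOf (q : ℕ × ℕ × ℕ) : ℚ := ((q.1 : ℚ) - (q.2.1 : ℚ)) / ((q.2.2 : ℚ) + 1)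

/-- A real function on a countable set is computable if its values can be approximated from below
and from above uniformly effectively: the sets of pairs `(a, q)` with `q < f a` and with `f a < q`
are computably enumerable. Equivalently, some algorithm computes from `a` and `k` a rational
number within `2 ^ (-k)` of `f a`. -/
def ComputableReal {α : Type} [Primcodable α] (f : α → ℝ) : Prop :=
  REPred (fun p : α × (ℕ × ℕ × ℕ) => ((ratOf p.2 : ℚ) : ℝ) < f p.1) ∧
  REPred (fun p : α × (ℕ × ℕ × ℕ) => f p.1 < ((ratOf p.2 : ℚ) : ℝ))

/-- A probability measure is computable if the probabilities of the cylinder sets are. -/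
def ComputableMeasure (R : Measure (Seq D)) : Prop :=
  IsProbabilityMeasure R ∧
  ComputableReal (fun p : Str D × Str D => R.real (cylinder p.1 p.2))

/-- The finite part `s_{-n+1}^n` of an oracle `s`. -/
def oracleWindow (s : Seq D) (n : ℕ) : Str D := word s (-(n : ℤ) + 1) (2 * n)

/-- The predicate `A` is computably enumerable with oracle `s`: `A a` holds exactly if it is
confirmed by a finite part of `s`, according to a computably enumerable set `W` of confirmations. -/
def CEIn {α : Type} [Primcodable α] (s : Seq D) (A : α → Prop) : Prop :=
  ∃ W : Str D × α → Prop, REPred W ∧ ∀ a, A a ↔ ∃ n, W (oracleWindow s n, a)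

/-- The predicates `A s` are computably enumerable with oracle `s`, by one and the same enumeration
procedure for all oracles `s`. -/
def UniformCE {α : Type} [Primcodable α] (A : Seq D → α → Prop) : Prop :=
  ∃ W : Str D × α → Prop, REPred W ∧ ∀ s a, A s a ↔ ∃ n, W (oracleWindow s n, a)

/-- A real function `(s, a) ↦ f s a`, where `s` is an infinite sequence used as an oracle,
is computable. -/
def ComputableRealFunctional {α : Type} [Primcodable α] (f : Seq D → α → ℝ) : Prop :=
  UniformCE (fun s (p : α × (ℕ × ℕ × ℕ)) => ((ratOf p.2 : ℚ) : ℝ) < f s p.1) ∧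
  UniformCE (fun s (p : α × (ℕ × ℕ × ℕ)) => f s p.1 < ((ratOf p.2 : ℚ) : ℝ))

/-- Representation functions: total computable maps from sequences to probability measures. -/
def IsRepresentationFunction (ρ : Seq D → Measure (Seq D)) : Prop :=
  (∀ s, IsProbabilityMeasure (ρ s)) ∧
  ComputableRealFunctional (fun s (p : Str D × Str D) => (ρ s).real (cylinder p.1 p.2))

/-- The sequence `s` is a representation of the measure `P`. -/
def IsRepresentation (s : Seq D) (P : Measure (Seq D)) : Prop :=
  ∃ ρ : Seq D → Measure (Seq D), IsRepresentationFunction ρ ∧ ρ s = P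

/-- The events `U 0, U 1, …` are uniformly `s`-c.e.: they are unions of cylinder sets given by
uniformly `s`-c.e. sets `V 0, V 1, …` of pairs of strings. -/
def UniformlyCEEvents (s : Seq D) (U : ℕ → Set (Seq D)) : Prop :=
  ∃ V : ℕ → Set (Str D × Str D),
    CEIn s (fun p : ℕ × (Str D × Str D) => p.2 ∈ V p.1) ∧
    ∀ n, U n = {x | ∃ p ∈ V n, x ∈ cylinder p.1 p.2}

/-- Martin-Löf `(s, P)`-tests. -/
def IsMartinLofTest (s : Seq D) (P : Measure (Seq D)) (U : ℕ → Set (Seq D)) : Prop :=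
  UniformlyCEEvents s U ∧ ∀ n, P.real (U n) ≤ 2⁻¹ ^ n

/-- `1`-`(s, P)`-random points. -/
def IsRandomRel (s : Seq D) (P : Measure (Seq D)) (x : Seq D) : Prop :=
  ∀ U : ℕ → Set (Seq D), IsMartinLofTest s P U → x ∉ ⋂ n, U n

/-- Martin-Löf `P`-random points, also called `1`-`P`-random. -/
def IsMartinLofRandom (P : Measure (Seq D)) (x : Seq D) : Prop :=
  ∃ s, IsRepresentation s P ∧ IsRandomRel s P x

/-- `1`-universal measures: computable probability measures `R` such that, for every stationary
ergodic `P`, `-log R(X_1^n) / n` tends to `h_P` on all `1`-`P`-random points. (The limit being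
finite, it is part of the definition that `R(X_1^n)` does not vanish there.) -/
def IsOneUniversal (R : Measure (Seq D)) : Prop :=
  ComputableMeasure R ∧
  ∀ P : Measure (Seq D), IsStationaryErgodic P → ∀ x, IsMartinLofRandom P x →
    (∀ n, 0 < prob R (word x 1 n)) ∧
    Tendsto (fun n : ℕ => -Real.logb 2 (prob R (word x 1 n)) / (n : ℝ)) atTop
      (𝓝 (entropyRate P))

end AlgRandom

end

/-! By the chain rule, `-log R(x_1^n)` is the sum of the code lengths `-log R(x_{i+1}|x_1^i)`, and
universality says that their averages tend to `h_P` on random points. It remains to show that, on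
random points, replacing each code length by its conditional mean under `P` does not change the
limit of the averages.

The differences form a martingale difference sequence. Up to rounding they are bounded by `o(√(i/ln
i))`, so their squared bounds add up to `o(n²/ln n)`. An Azuma-type inequality
(`measureReal_sum_gt_le`) then makes a deviation of order `n` so unlikely that the probabilities are
summable with explicit tails, and an effective Borel–Cantelli lemma (`IsRandomRel.eventually_not`)
excludes such deviations from some `n` on.

For this to be a Martin-Löf test, the deviation events must be enumerable with the oracle `s` that
represents `P`. Real code lengths are therefore replaced by computable integers in units of `log (1
+ 1/k)` (`exists_computable_codeLength`), and conditional means by integer bounds that the oracle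
can confirm (`IsRandomRel.eventually_sum_le`, `IsRandomRel.eventually_sum_ge`). All errors are a
bounded number of units per symbol, hence `O(1/k)` on average (`eventually_abs_codeLength_sub_le`),
and `k` is arbitrary. -/

namespace AlgRandom

/-! ### Computable functions -/

section Computability

variable {α β : Type} [Primcodable α] [Primcodable β]

theorem computable_bool_not {f : α → Bool} (hf : Computable f) : Computable fun a => !f a :=
  Primrec.not.to_comp.comp hf

theorem computable_bool_and {f g : α → Bool} (hf : Computable f) (hg : Computable g) :
    Computable fun a => f a && g a :=
  Primrec.and.to_comp.comp hf hg

theorem computable_bool_or {f g : α → Bool} (hf : Computable f) (hg : Computable g) :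
    Computable fun a => f a || g a :=
  Primrec.or.to_comp.comp hf hg

theorem computable_nat_add {f g : α → ℕ} (hf : Computable f) (hg : Computable g) :
    Computable fun a => f a + g a :=
  Primrec.nat_add.to_comp.comp hf hg

theorem computable_nat_mul {f g : α → ℕ} (hf : Computable f) (hg : Computable g) :
    Computable fun a => f a * g a :=
  Primrec.nat_mul.to_comp.comp hf hg

theorem computable_nat_lt {f g : α → ℕ} (hf : Computable f) (hg : Computable g) :
    Computable fun a => decide (f a < g a) :=
  (Primrec.nat_lt.decide.to_comp.comp hf hg : _)

theorem computable_nat_le {f g : α → ℕ} (hf : Computable f) (hg : Computable g) :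
    Computable fun a => decide (f a ≤ g a) :=
  (Primrec.nat_le.decide.to_comp.comp hf hg : _)

theorem computable_nat_pow (k : ℕ) {f : α → ℕ} (hf : Computable f) :
    Computable fun a => k ^ f a := by
  refine (Computable.nat_rec (f := f) (g := fun _ => 1) (h := fun _ p => k * p.2) hf
    (Computable.const 1) ?_).of_eq fun a => ?_
  · exact computable_nat_mul (Computable.const k) (Computable.snd.comp Computable.snd)
  · induction f a with
    | zero => rfl
    | succ n ih => rw [pow_succ', ← ih]

theorem computable_sum_range {f : α → ℕ} {g : α × ℕ → ℕ} (hf : Computable f) (hg : Computable g) :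
    Computable fun a => ∑ i ∈ Finset.range (f a), g (a, i) := by
  refine (Computable.nat_rec (f := f) (g := fun _ => 0) (h := fun a p => p.2 + g (a, p.1)) hf
    (Computable.const 0) ?_).of_eq fun a => ?_
  · exact computable_nat_add (Computable.snd.comp Computable.snd)
      (hg.comp (Computable.fst.pair (Computable.fst.comp Computable.snd)))
  · induction f a with
    | zero => rfl
    | succ n ih => rw [Finset.sum_range_succ, ← ih]

theorem computable_finset_sum {ι : Type} (t : Finset ι) {f : ι → α → ℕ}
    (hf : ∀ i, Computable (f i)) : Computable fun a => ∑ i ∈ t, f i a := by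
  classical
  induction t using Finset.induction_on with
  | empty => simpa using Computable.const 0
  | insert i t hi ih => simpa [Finset.sum_insert hi] using computable_nat_add (hf i) ih

theorem computable_exists_lt {f : α → ℕ} {g : α × ℕ → Bool} (hf : Computable f)
    (hg : Computable g) : Computable fun a => decide (∃ i < f a, g (a, i) = true) := by
  refine (Computable.nat_rec (f := f) (g := fun _ => false) (h := fun a p => p.2 || g (a, p.1)) hf
    (Computable.const false) ?_).of_eq fun a => ?_
  · exact computable_bool_or (Computable.snd.comp Computable.snd)
      (hg.comp (Computable.fst.pair (Computable.fst.comp Computable.snd)))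
  · induction f a with
    | zero => simp
    | succ n ih =>
      rw [Bool.eq_iff_iff] at ih ⊢
      simp only [Bool.or_eq_true, ih, decide_eq_true_eq]
      simp only [Nat.lt_succ_iff_lt_or_eq, or_and_right, exists_or, exists_eq_left]

theorem computable_forall_lt {f : α → ℕ} {g : α × ℕ → Bool} (hf : Computable f)
    (hg : Computable g) : Computable fun a => decide (∀ i < f a, g (a, i) = true) := by
  refine (computable_bool_not (computable_exists_lt hf (computable_bool_not hg))).of_eq fun a => ?_
  rw [Bool.eq_iff_iff]
  simp

/-- A computably enumerable set is the projection of a computable one. -/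
theorem rePred_exists_stage {p : α → Prop} (hp : REPred p) :
    ∃ B : α × ℕ → Bool, Computable B ∧ ∀ a, p a ↔ ∃ t, B (a, t) = true := by
  obtain ⟨c, hc⟩ := Nat.Partrec.Code.exists_code.1 hp
  refine ⟨fun q => (Nat.Partrec.Code.evaln q.2 c (Encodable.encode q.1)).isSome, ?_, fun a => ?_⟩
  · exact Primrec.option_isSome.to_comp.comp (Nat.Partrec.Code.primrec_evaln.to_comp.comp
      ((Computable.snd.pair (Computable.const c)).pair (Computable.encode.comp Computable.fst)))
  · have h1 : (Nat.Partrec.Code.eval c (Encodable.encode a)).Dom ↔ p a := by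
      rw [hc]
      simp [Encodable.encodek, Part.assert]
    rw [← h1, Part.dom_iff_mem]
    simp only [Nat.Partrec.Code.evaln_complete, Option.isSome_iff_exists]
    exact ⟨fun ⟨y, k, h⟩ => ⟨k, y, h⟩, fun ⟨k, y, h⟩ => ⟨y, k, h⟩⟩

theorem rePred_of_computable {B : α → Bool} (hB : Computable B) : REPred fun a => B a = true :=
  ComputablePred.to_re (ComputablePred.computable_iff.2 ⟨B, hB, rfl⟩)

end Computability

/-! ### Predicates that are computably enumerable with an oracle -/

section CEIn

variable {D : ℕ} {α β : Type} [Primcodable α] [Primcodable β] {s : Seq D}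

theorem length_word (x : Seq D) (j : ℤ) (n : ℕ) : (word x j n).length = n := by simp [word]

theorem length_oracleWindow (s : Seq D) (n : ℕ) : (oracleWindow s n).length = 2 * n :=
  length_word _ _ _

/-- The central part of length `2 * m` of a string of even length. -/
def middle (σ : Str D) (m : ℕ) : Str D := (σ.drop (σ.length / 2 - m)).take (2 * m)

/-- A larger window contains all smaller ones, so a confirmation found once can be repeated from
every larger window. This gives the monotonicity in `CEIn.exists_check`. -/
theorem middle_oracleWindow (s : Seq D) {m n : ℕ} (h : m ≤ n) :
    middle (oracleWindow s n) m = oracleWindow s m := by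
  apply List.ext_getElem
  · simp [middle, length_oracleWindow]; omega
  · intro i h1 h2
    have h3 : 2 * n / 2 = n := by omega
    simp only [middle, length_oracleWindow, h3]
    simp only [oracleWindow, word, List.getElem_take, List.getElem_drop, List.getElem_map,
      List.getElem_range]
    congr 1
    push_cast [h]
    ring

theorem computable_middle : Computable fun p : Str D × ℕ => middle p.1 p.2 := by
  have hlen : Primrec fun p : Str D × ℕ => p.1.length / 2 - p.2 :=
    Primrec.nat_sub.comp (Primrec.nat_div.comp (Primrec.list_length.comp Primrec.fst)
      (Primrec.const 2)) Primrec.snd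
  exact (Primrec.list_take.comp (Primrec.nat_mul.comp (Primrec.const 2) Primrec.snd)
    (Primrec.list_drop.comp hlen Primrec.fst)).to_comp

theorem CEIn.of_rePred {A : α → Prop} (h : REPred A) : CEIn s A := by
  refine ⟨fun p => A p.2, ?_, fun a => by simp⟩
  exact Partrec.comp h Computable.snd

/-- Normal form: confirmation by finite parts of the oracle can be taken decidable and monotone. -/
theorem CEIn.exists_check {A : α → Prop} (h : CEIn s A) :
    ∃ B : Str D × α → Bool, Computable B ∧
      (∀ a m n, m ≤ n → B (oracleWindow s m, a) = true → B (oracleWindow s n, a) = true) ∧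
      ∀ a, A a ↔ ∃ n, B (oracleWindow s n, a) = true := by
  obtain ⟨W, hW, hA⟩ := h
  obtain ⟨C, hC, hWC⟩ := rePred_exists_stage hW
  -- The number `p.2` codes a pair: the size of a smaller window and a stage of the enumeration. The
  -- guard ensures that `middle` returns a genuine smaller window.
  let g : (Str D × α) × ℕ → Bool := fun p =>
    decide (p.2.unpair.1 ≤ p.1.1.length / 2) &&
      C ((middle p.1.1 p.2.unpair.1, p.1.2), p.2.unpair.2)
  have hu : Computable fun p : (Str D × α) × ℕ => p.2.unpair :=
    Primrec.unpair.to_comp.comp Computable.snd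
  have hσ : Computable fun p : (Str D × α) × ℕ => p.1.1 := Computable.fst.comp Computable.fst
  have hlen : Computable fun p : (Str D × α) × ℕ => p.1.1.length / 2 :=
    (Primrec.nat_div.comp Primrec.list_length (Primrec.const 2)).to_comp.comp hσ
  have hg : Computable g :=
    computable_bool_and (computable_nat_le (Computable.fst.comp hu) hlen)
      (hC.comp (((computable_middle.comp (hσ.pair (Computable.fst.comp hu))).pair
        (Computable.snd.comp Computable.fst)).pair (Computable.snd.comp hu)))
  have key : ∀ a n i, g ((oracleWindow s n, a), i) = true ↔
      i.unpair.1 ≤ n ∧ C ((oracleWindow s i.unpair.1, a), i.unpair.2) = true := by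
    intro a n i
    have h3 : 2 * n / 2 = n := by omega
    simp only [g, Bool.and_eq_true, decide_eq_true_eq, length_oracleWindow, h3]
    refine and_congr_right fun hi => ?_
    rw [middle_oracleWindow s hi]
  refine ⟨fun p => decide (∃ i < p.1.length, g (p, i) = true), ?_, ?_, ?_⟩
  · exact computable_exists_lt (Primrec.list_length.to_comp.comp Computable.fst) hg
  · intro a m n hmn
    simp only [decide_eq_true_eq, key, length_oracleWindow]
    rintro ⟨i, hi, h1, h2⟩
    exact ⟨i, by omega, h1.trans hmn, h2⟩
  · intro a
    simp only [decide_eq_true_eq, key, length_oracleWindow, hA, hWC]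
    constructor
    · rintro ⟨m, t, h⟩
      refine ⟨Nat.pair m t + m + 1, Nat.pair m t, by omega, ?_⟩
      simp only [Nat.unpair_pair]
      exact ⟨by omega, h⟩
    · rintro ⟨n, i, -, -, h⟩
      exact ⟨_, _, h⟩

theorem CEIn.of_check {A : α → Prop} {B : Str D × α → Bool} (hB : Computable B)
    (h : ∀ a, A a ↔ ∃ n, B (oracleWindow s n, a) = true) : CEIn s A :=
  ⟨_, rePred_of_computable hB, h⟩

theorem CEIn.of_computable {B : α → Bool} (hB : Computable B) : CEIn s fun a => B a = true :=
  CEIn.of_rePred (rePred_of_computable hB)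

theorem CEIn.congr {A A' : α → Prop} (h : CEIn s A) (h' : ∀ a, A' a ↔ A a) : CEIn s A' :=
  (funext fun a => propext (h' a) : A' = A) ▸ h

theorem CEIn.comp {A : α → Prop} (h : CEIn s A) {g : β → α} (hg : Computable g) :
    CEIn s fun b => A (g b) := by
  obtain ⟨B, hB, -, hA⟩ := h.exists_check
  exact CEIn.of_check (B := fun p => B (p.1, g p.2))
    (hB.comp (Computable.fst.pair (hg.comp Computable.snd))) fun b => hA (g b)

/-- Monotonicity of the checks lets two confirmations from different windows be read off one common
window. -/
theorem CEIn.and {A A' : α → Prop} (h : CEIn s A) (h' : CEIn s A') :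
    CEIn s fun a => A a ∧ A' a := by
  obtain ⟨B, hB, hm, hA⟩ := h.exists_check
  obtain ⟨B', hB', hm', hA'⟩ := h'.exists_check
  refine CEIn.of_check (computable_bool_and hB hB') fun a => ?_
  simp only [hA, hA', Bool.and_eq_true]
  constructor
  · rintro ⟨⟨m, h1⟩, n, h2⟩
    exact ⟨max m n, hm _ _ _ (le_max_left _ _) h1, hm' _ _ _ (le_max_right _ _) h2⟩
  · rintro ⟨n, h1, h2⟩
    exact ⟨⟨n, h1⟩, n, h2⟩

theorem CEIn.or {A A' : α → Prop} (h : CEIn s A) (h' : CEIn s A') :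
    CEIn s fun a => A a ∨ A' a := by
  obtain ⟨B, hB, -, hA⟩ := h.exists_check
  obtain ⟨B', hB', -, hA'⟩ := h'.exists_check
  refine CEIn.of_check (computable_bool_or hB hB') fun a => ?_
  simp only [hA, hA', Bool.or_eq_true, exists_or]

/-- The search for `b` is bounded by the window length, which keeps the check decidable; enlarging
the window eventually reaches the code of every `b`. -/
theorem CEIn.exists {A : α × β → Prop} (h : CEIn s A) : CEIn s fun a => ∃ b, A (a, b) := by
  obtain ⟨B, hB, hm, hA⟩ := h.exists_check
  let g : (Str D × α) × ℕ → Bool := fun p =>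
    ((Encodable.decode p.2 : Option β).map fun b => B (p.1.1, (p.1.2, b))).getD false
  have hg : Computable g := by
    refine Computable.option_getD (Computable.option_map
      (Computable.decode.comp Computable.snd) ?_) (Computable.const false)
    exact hB.comp ((Computable.fst.comp (Computable.fst.comp Computable.fst)).pair
      ((Computable.snd.comp (Computable.fst.comp Computable.fst)).pair Computable.snd))
  refine CEIn.of_check (computable_exists_lt
    (Primrec.list_length.to_comp.comp Computable.fst) hg) fun a => ?_
  simp only [decide_eq_true_eq, length_oracleWindow, hA]
  constructor
  · rintro ⟨b, n, h⟩
    refine ⟨n + Encodable.encode b + 1, Encodable.encode b, by omega, ?_⟩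
    simpa [g] using hm _ _ _ (by omega) h
  · rintro ⟨n, i, -, h⟩
    rcases hd : (Encodable.decode i : Option β) with _ | b
    · simp [g, hd] at h
    · exact ⟨b, n, by simpa [g, hd] using h⟩

theorem CEIn.forall_lt {A : α × ℕ → Prop} (h : CEIn s A) {f : α → ℕ} (hf : Computable f) :
    CEIn s fun a => ∀ i < f a, A (a, i) := by
  obtain ⟨B, hB, hm, hA⟩ := h.exists_check
  have hg : Computable fun p : (Str D × α) × ℕ => B (p.1.1, (p.1.2, p.2)) :=
    hB.comp ((Computable.fst.comp Computable.fst).pair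
      ((Computable.snd.comp Computable.fst).pair Computable.snd))
  refine CEIn.of_check (computable_forall_lt (hf.comp Computable.snd) hg) fun a => ?_
  simp only [decide_eq_true_eq, hA]
  constructor
  · intro h
    choose! n hn using h
    refine ⟨(Finset.range (f a)).sup n, fun i hi => hm _ _ _ ?_ (hn i hi)⟩
    exact Finset.le_sup (f := n) (Finset.mem_range.2 hi)
  · rintro ⟨n, h⟩ i hi
    exact ⟨n, h i hi⟩

theorem CEIn.forall_mem_finset {ι : Type} (t : Finset ι) {A : ι → α → Prop}
    (h : ∀ i, CEIn s (A i)) : CEIn s fun a => ∀ i ∈ t, A i a := by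
  classical
  induction t using Finset.induction_on with
  | empty => simpa using CEIn.of_computable (s := s) (α := α) (Computable.const true)
  | insert i t hi ih => simpa using (h i).and ih

theorem CEIn.forall_fintype {ι : Type} [Fintype ι] {A : ι → α → Prop}
    (h : ∀ i, CEIn s (A i)) : CEIn s fun a => ∀ i, A i a := by
  simpa using CEIn.forall_mem_finset Finset.univ h

/-- A relation that is total and computably enumerable with a computable oracle contains the graph
of a computable function. -/
theorem CEIn.exists_computable_selector (hs : Computable (oracleWindow s)) {A : α × ℕ → Prop}
    (h : CEIn s A) (htot : ∀ a, ∃ m, A (a, m)) :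
    ∃ f : α → ℕ, Computable f ∧ ∀ a, A (a, f a) := by
  obtain ⟨B, hB, -, hA⟩ := h.exists_check
  have hu : Computable fun p : α × ℕ => p.2.unpair :=
    Primrec.unpair.to_comp.comp Computable.snd
  have hC : Computable fun p : α × ℕ =>
      B (oracleWindow s p.2.unpair.2, (p.1, p.2.unpair.1)) :=
    hB.comp ((hs.comp (Computable.snd.comp hu)).pair
      (Computable.fst.pair (Computable.fst.comp hu)))
  have hex : ∀ a : α, ∃ k : ℕ, B (oracleWindow s k.unpair.2, (a, k.unpair.1)) = true := by
    intro a
    obtain ⟨m, hm⟩ := htot a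
    obtain ⟨n, hn⟩ := (hA _).1 hm
    exact ⟨Nat.pair m n, by simpa using hn⟩
  have hfind := Computable.find
    (P := fun (a : α) (k : ℕ) => B (oracleWindow s k.unpair.2, (a, k.unpair.1)) = true)
    (ComputablePred.computable_iff.2 ⟨_, hC, rfl⟩) hex
  refine ⟨fun a => (Nat.find (hex a)).unpair.1,
    Computable.fst.comp (Primrec.unpair.to_comp.comp hfind), fun a => ?_⟩
  exact (hA _).2 ⟨_, Nat.find_spec (hex a)⟩

/-- A constant oracle carries no information, so the oracle calculus also applies to the computable
measure `R`. -/
theorem computable_oracleWindow_const (c : Fin D) :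
    Computable (oracleWindow (fun _ => c : Seq D)) := by
  have : Primrec fun n : ℕ => (List.range (2 * n)).map fun _ => c :=
    Primrec.list_map (Primrec.list_range.comp (Primrec.nat_mul.comp (Primrec.const 2) Primrec.id))
      (Primrec.const c).to₂
  exact this.to_comp

end CEIn

end AlgRandom

namespace AlgRandom

/-! ### Probabilities of words -/

section Words

variable {D : ℕ} (P : Measure (Seq D))

theorem word_succ (x : Seq D) (j : ℤ) (n : ℕ) : word x j (n + 1) = word x j n ++ [x (j + n)] := by
  simp [word, List.range_succ]

theorem take_word (x : Seq D) (j : ℤ) {i n : ℕ} (h : i ≤ n) :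
    (word x j n).take i = word x j i := by
  simp [word, ← List.map_take, List.take_range, h]

theorem cylinder_nil (w : Str D) : cylinder [] w = {x | word x 1 w.length = w} := by
  simp [cylinder]

theorem prob_nonneg (w : Str D) : 0 ≤ prob P w := measureReal_nonneg

theorem prob_nil [IsProbabilityMeasure P] : prob P [] = 1 := by
  simp [prob, word]

theorem setOf_word_concat (w : Str D) (a : Fin D) :
    {x : Seq D | word x 1 (w ++ [a]).length = w ++ [a]} =
      {x | word x 1 w.length = w} ∩ {x | x (1 + w.length) = a} := by
  ext x
  simp [word_succ]

theorem measurableSet_coord (i : ℤ) (a : Fin D) : MeasurableSet {x : Seq D | x i = a} :=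
  (measurable_pi_apply i : Measurable fun x : Seq D => x i) (measurableSet_singleton a)

theorem measurableSet_word (w : Str D) : MeasurableSet {x : Seq D | word x 1 w.length = w} := by
  induction w using List.reverseRecOn with
  | nil => simp [word]
  | append_singleton w a ih =>
    rw [setOf_word_concat]
    exact ih.inter (measurableSet_coord _ a)

theorem prob_concat_le [IsProbabilityMeasure P] (w : Str D) (a : Fin D) :
    prob P (w ++ [a]) ≤ prob P w := by
  unfold prob
  rw [setOf_word_concat]
  exact measureReal_mono Set.inter_subset_left

theorem sum_prob_concat [IsProbabilityMeasure P] (w : Str D) :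
    ∑ a, prob P (w ++ [a]) = prob P w := by
  unfold prob
  simp only [setOf_word_concat]
  rw [← measureReal_biUnion_finset]
  · congr 1
    ext x
    simp
  · intro a _ b _ hab
    rw [Function.onFun, Set.disjoint_left]
    rintro x ⟨_, h1⟩ ⟨_, h2⟩
    exact hab (h1.symm.trans h2)
  · intro a _
    exact (measurableSet_word w).inter (measurableSet_coord _ a)

theorem condProb_nonneg (w : Str D) (a : Fin D) : 0 ≤ condProb P w a :=
  div_nonneg (prob_nonneg P _) (prob_nonneg P _)

theorem prob_mul_condProb [IsProbabilityMeasure P] (w : Str D) (a : Fin D) :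
    prob P w * condProb P w a = prob P (w ++ [a]) := by
  unfold condProb
  rcases (prob_nonneg P w).eq_or_lt with h | h
  -- If `w` is null, so are its extensions, and the default value of the quotient does no harm.
  · have := prob_concat_le P w a
    have := prob_nonneg P (w ++ [a])
    rw [← h]
    linarith
  · field_simp

theorem sum_condProb [IsProbabilityMeasure P] {w : Str D} (hw : 0 < prob P w) :
    ∑ a, condProb P w a = 1 := by
  unfold condProb
  rw [← Finset.sum_div, sum_prob_concat, div_self hw.ne']

theorem sum_condProb_le [IsProbabilityMeasure P] (w : Str D) : ∑ a, condProb P w a ≤ 1 := by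
  unfold condProb
  rw [← Finset.sum_div, sum_prob_concat]
  exact div_self_le_one _

end Words

/-! ### Measures with oracle-computable probabilities of words -/

section ProbCE

variable {D : ℕ} {α : Type} [Primcodable α] {s : Seq D} {P : Measure (Seq D)}

/-- The probabilities of words can be approximated from both sides with the oracle `s`. -/
def ProbCE (s : Seq D) (P : Measure (Seq D)) : Prop :=
  CEIn s (fun p : Str D × ℕ × ℕ => (p.2.1 : ℝ) / (p.2.2 + 1) < prob P p.1) ∧
  CEIn s (fun p : Str D × ℕ × ℕ => prob P p.1 < (p.2.1 : ℝ) / (p.2.2 + 1))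

theorem ProbCE.of_cylinder
    (h1 : CEIn s fun p : (Str D × Str D) × (ℕ × ℕ × ℕ) =>
      ((ratOf p.2 : ℚ) : ℝ) < P.real (cylinder p.1.1 p.1.2))
    (h2 : CEIn s fun p : (Str D × Str D) × (ℕ × ℕ × ℕ) =>
      P.real (cylinder p.1.1 p.1.2) < ((ratOf p.2 : ℚ) : ℝ)) : ProbCE s P := by
  have hg : Computable fun p : Str D × ℕ × ℕ =>
      ((([] : Str D), p.1), (p.2.1, 0, p.2.2)) :=
    ((Computable.const []).pair Computable.fst).pair
      ((Computable.fst.comp Computable.snd).pair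
        ((Computable.const 0).pair (Computable.snd.comp Computable.snd)))
  refine ⟨(h1.comp hg).congr fun p => ?_, (h2.comp hg).congr fun p => ?_⟩ <;>
  simp [cylinder_nil, prob, ratOf]

theorem ComputableMeasure.probCE (h : ComputableMeasure P) (s : Seq D) : ProbCE s P :=
  ProbCE.of_cylinder (CEIn.of_rePred h.2.1) (CEIn.of_rePred h.2.2)

theorem IsRepresentation.probCE (h : IsRepresentation s P) : ProbCE s P := by
  obtain ⟨ρ, ⟨-, ⟨W, hW, hA⟩, ⟨W', hW', hA'⟩⟩, rfl⟩ := h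
  exact ProbCE.of_cylinder ⟨W, hW, hA s⟩ ⟨W', hW', hA' s⟩

/-- Strict inequalities between linear combinations of probabilities of words are computably
enumerable. -/
theorem ProbCE.sum_lt_sum (h : ProbCE s P) {m n : ℕ} {a : Fin m → α → ℕ} {b : Fin n → α → ℕ}
    {u : Fin m → α → Str D} {v : Fin n → α → Str D}
    (ha : ∀ i, Computable (a i)) (hb : ∀ j, Computable (b j))
    (hu : ∀ i, Computable (u i)) (hv : ∀ j, Computable (v j)) :
    CEIn s fun x => ∑ i, (a i x : ℝ) * prob P (u i x) < ∑ j, (b j x : ℝ) * prob P (v j x) := by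
  have happ : ∀ {k : ℕ} (i : Fin k), Computable fun f : Fin k → ℕ => f i := fun i =>
    (Primrec.fin_app.comp Primrec.id (Primrec.const i)).to_comp
  have hx : Computable fun p : α × ℕ × (Fin m → ℕ) × (Fin n → ℕ) => p.1 := Computable.fst
  have hc : Computable fun p : α × ℕ × (Fin m → ℕ) × (Fin n → ℕ) => p.2.1 :=
    Computable.fst.comp Computable.snd
  have hU : ∀ i, Computable fun p : α × ℕ × (Fin m → ℕ) × (Fin n → ℕ) => p.2.2.1 i := fun i =>
    (happ i).comp (Computable.fst.comp (Computable.snd.comp Computable.snd))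
  have hL : ∀ j, Computable fun p : α × ℕ × (Fin m → ℕ) × (Fin n → ℕ) => p.2.2.2 j := fun j =>
    (happ j).comp (Computable.snd.comp (Computable.snd.comp Computable.snd))
  -- The witnesses are a common denominator `c + 1`, numerators of upper bounds on the left and of
  -- lower bounds on the right. The numerator `0` is admitted without confirmation, because `0 <
  -- prob P w` fails for null words.
  have key : CEIn s fun p : α × ℕ × (Fin m → ℕ) × (Fin n → ℕ) =>
      (∀ i, prob P (u i p.1) < (p.2.2.1 i : ℝ) / (p.2.1 + 1)) ∧
      (∀ j, decide (p.2.2.2 j ≤ 0) = true ∨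
        (p.2.2.2 j : ℝ) / (p.2.1 + 1) < prob P (v j p.1)) ∧
      decide (∑ i, a i p.1 * p.2.2.1 i < ∑ j, b j p.1 * p.2.2.2 j) = true := by
    refine (CEIn.forall_fintype fun i => ?_).and ((CEIn.forall_fintype fun j => ?_).and ?_)
    · exact h.2.comp (((hu i).comp hx).pair ((hU i).pair hc))
    · exact (CEIn.of_computable (computable_nat_le (hL j) (Computable.const 0))).or
        (h.1.comp (((hv j).comp hx).pair ((hL j).pair hc)))
    · exact CEIn.of_computable (computable_nat_lt
        (computable_finset_sum _ fun i => computable_nat_mul ((ha i).comp hx) (hU i))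
        (computable_finset_sum _ fun j => computable_nat_mul ((hb j).comp hx) (hL j)))
  refine key.exists.congr fun x => ⟨fun hlt => ?_, ?_⟩
  · set Δ := ∑ j, (b j x : ℝ) * prob P (v j x) - ∑ i, (a i x : ℝ) * prob P (u i x) with hΔ
    have hΔ0 : 0 < Δ := sub_pos.2 hlt
    -- Rounding shifts each probability by at most `1/(c + 1)`; this `c` keeps the weighted total of
    -- the shifts below the gap `Δ`.
    obtain ⟨c, hcΔ⟩ := exists_nat_gt ((∑ i, (a i x : ℝ) + ∑ j, (b j x : ℝ)) / Δ)
    rw [div_lt_iff₀ hΔ0] at hcΔ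
    have hc1 : (0 : ℝ) < c + 1 := by positivity
    have hceil : ∀ j, ((⌈prob P (v j x) * (c + 1)⌉₊ - 1 : ℕ) : ℝ) ≥
        prob P (v j x) * (c + 1) - 1 := by
      intro j
      have h1 := Nat.le_ceil (prob P (v j x) * (c + 1))
      have h2 : ((⌈prob P (v j x) * (c + 1)⌉₊ : ℕ) : ℝ) ≤
          ((⌈prob P (v j x) * (c + 1)⌉₊ - 1 : ℕ) : ℝ) + 1 := by
        exact_mod_cast Nat.le_succ_of_pred_le le_rfl
      linarith
    refine ⟨(c, fun i => ⌊prob P (u i x) * (c + 1)⌋₊ + 1,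
      fun j => ⌈prob P (v j x) * (c + 1)⌉₊ - 1), fun i => ?_, fun j => ?_, ?_⟩
    · rw [lt_div_iff₀ hc1]
      push_cast
      exact Nat.lt_floor_add_one _
    · rw [decide_eq_true_eq]
      rcases Nat.eq_zero_or_pos (⌈prob P (v j x) * (c + 1)⌉₊ - 1) with h0 | h0
      · exact Or.inl h0.le
      · right
        rw [div_lt_iff₀ hc1]
        exact Nat.lt_ceil.1 (by simp only at h0 ⊢; omega)
    · rw [decide_eq_true_eq, ← Nat.cast_lt (α := ℝ)]
      push_cast
      have e1 : ∑ i, (a i x : ℝ) * (⌊prob P (u i x) * (c + 1)⌋₊ + 1) ≤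
          ∑ i, ((a i x : ℝ) * prob P (u i x) * (c + 1) + a i x) := by
        refine Finset.sum_le_sum fun i _ => ?_
        have := Nat.floor_le (mul_nonneg (prob_nonneg P (u i x)) hc1.le)
        have h0 : (0 : ℝ) ≤ a i x := Nat.cast_nonneg _
        nlinarith
      have e2 : ∑ j, ((b j x : ℝ) * prob P (v j x) * (c + 1) - b j x) ≤
          ∑ j, (b j x : ℝ) * ((⌈prob P (v j x) * (c + 1)⌉₊ - 1 : ℕ) : ℝ) := by
        refine Finset.sum_le_sum fun j _ => ?_
        have h0 : (0 : ℝ) ≤ b j x := Nat.cast_nonneg _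
        nlinarith [hceil j]
      rw [Finset.sum_add_distrib, ← Finset.sum_mul] at e1
      rw [Finset.sum_sub_distrib, ← Finset.sum_mul] at e2
      have : (c + 1 : ℝ) * Δ = (∑ j, (b j x : ℝ) * prob P (v j x)) * (c + 1) -
          (∑ i, (a i x : ℝ) * prob P (u i x)) * (c + 1) := by rw [hΔ]; ring
      nlinarith
  · rintro ⟨⟨c, U, L⟩, h1, h2, h3⟩
    simp only [decide_eq_true_eq] at h1 h2 h3
    have hc1 : (0 : ℝ) < c + 1 := by positivity
    rw [← Nat.cast_lt (α := ℝ)] at h3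
    push_cast at h3
    have e1 : ∑ i, (a i x : ℝ) * prob P (u i x) ≤ (∑ i, (a i x : ℝ) * U i) / (c + 1) := by
      rw [Finset.sum_div]
      refine Finset.sum_le_sum fun i _ => ?_
      rw [mul_div_assoc]
      exact mul_le_mul_of_nonneg_left (h1 i).le (Nat.cast_nonneg _)
    have e2 : (∑ j, (b j x : ℝ) * L j) / (c + 1) ≤ ∑ j, (b j x : ℝ) * prob P (v j x) := by
      rw [Finset.sum_div]
      refine Finset.sum_le_sum fun j _ => ?_
      rw [mul_div_assoc]
      refine mul_le_mul_of_nonneg_left ?_ (Nat.cast_nonneg _)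
      rcases h2 j with h0 | h0
      · simpa [Nat.le_zero.1 h0] using prob_nonneg P _
      · exact h0.le
    exact e1.trans_lt ((div_lt_div_of_pos_right h3 hc1).trans_le e2)

theorem ProbCE.mul_lt_mul (h : ProbCE s P) {a b : α → ℕ} {u v : α → Str D}
    (ha : Computable a) (hb : Computable b) (hu : Computable u) (hv : Computable v) :
    CEIn s fun x => (a x : ℝ) * prob P (u x) < (b x : ℝ) * prob P (v x) := by
  simpa using h.sum_lt_sum (m := 1) (n := 1) (a := fun _ => a) (b := fun _ => b)
    (u := fun _ => u) (v := fun _ => v) (fun _ => ha) (fun _ => hb) (fun _ => hu) fun _ => hv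

/-- Divided by `prob P p.1` when it is positive, this compares the conditional mean of `f` with an
integer. The product form avoids division by zero on null words. `ProbCE.lt_sum_concat` is the
opposite comparison. -/
theorem ProbCE.sum_concat_lt (h : ProbCE s P) {f : Str D → ℕ} (hf : Computable f) :
    CEIn s fun p : Str D × ℕ =>
      ∑ a, (f (p.1 ++ [a]) : ℝ) * prob P (p.1 ++ [a]) < p.2 * prob P p.1 := by
  have hconc : ∀ a : Fin D, Computable fun p : Str D × ℕ => p.1 ++ [a] := fun a =>
    (Primrec.list_concat.comp Primrec.fst (Primrec.const a)).to_comp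
  simpa using h.sum_lt_sum (m := D) (n := 1) (b := fun _ (p : Str D × ℕ) => p.2)
    (v := fun _ p => p.1) (fun a => hf.comp (hconc a)) (fun _ => Computable.snd) hconc
    fun _ => Computable.fst

theorem ProbCE.lt_sum_concat (h : ProbCE s P) {f : Str D → ℕ} (hf : Computable f) :
    CEIn s fun p : Str D × ℕ =>
      p.2 * prob P p.1 < ∑ a, (f (p.1 ++ [a]) : ℝ) * prob P (p.1 ++ [a]) := by
  have hconc : ∀ a : Fin D, Computable fun p : Str D × ℕ => p.1 ++ [a] := fun a =>
    (Primrec.list_concat.comp Primrec.fst (Primrec.const a)).to_comp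
  simpa using h.sum_lt_sum (m := 1) (n := D) (a := fun _ (p : Str D × ℕ) => p.2)
    (u := fun _ p => p.1) (fun _ => Computable.snd) (fun a => hf.comp (hconc a))
    (fun _ => Computable.fst) hconc

/-- The code lengths `-log R(a|w)`, in units of `log (1 + 1/k)`, can be computed up to a bounded
error. -/
theorem exists_computable_codeLength {R : Measure (Seq D)} (hR : ComputableMeasure R) (c : Fin D)
    (hpos : ∀ w : Str D, 2 ≤ w.length → ∀ a, 0 < condProb R w a) {k : ℕ} (hk : 0 < k) :
    ∃ f : Str D → ℕ, Computable f ∧ (∀ v, 1 ≤ f v) ∧ (∀ v, v.length < 3 → f v = 1) ∧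
      ∀ w : Str D, 2 ≤ w.length → ∀ a,
        |-Real.log (condProb R w a) - f (w ++ [a]) * Real.log ((k + 1) / k)| ≤
          2 * Real.log ((k + 1) / k) := by
  have := hR.1
  have hRs := hR.probCE fun _ => c
  have hv : Computable fun p : Str D × ℕ => p.1 := Computable.fst
  have hu : Computable fun p : Str D × ℕ => p.1.take (p.1.length - 1) :=
    (Primrec.list_take.comp (Primrec.nat_sub.comp (Primrec.list_length.comp Primrec.fst)
      (Primrec.const 1)) Primrec.fst).to_comp
  have hk1 : Computable fun p : Str D × ℕ => (k + 1) ^ p.2 :=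
    computable_nat_pow (k + 1) Computable.snd
  have hk2 : Computable fun p : Str D × ℕ => k ^ p.2 := computable_nat_pow k Computable.snd
  -- With `θ = (k + 1)/k` and `r = 1/R(a|w)`, the second alternative says `θ^(m-1) < r < θ^(m+1)`.
  -- These open conditions overlap, so some `m` is always confirmed although equality of reals is
  -- undecidable. Words shorter than 3, where the bound on `R` is not available, get the default
  -- `0`.
  have hA : CEIn (fun _ => c : Seq D) fun p : Str D × ℕ =>
      ((decide (p.1.length < 3) && decide (p.2 ≤ 0)) = true) ∨
      ((((k + 1) ^ p.2 * k : ℕ) : ℝ) * prob R p.1 <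
          ((k ^ p.2 * (k + 1) : ℕ) : ℝ) * prob R (p.1.take (p.1.length - 1)) ∧
        ((k ^ p.2 * k : ℕ) : ℝ) * prob R (p.1.take (p.1.length - 1)) <
          (((k + 1) ^ p.2 * (k + 1) : ℕ) : ℝ) * prob R p.1 ∧
        decide (3 ≤ p.1.length) = true) := by
    refine (CEIn.of_computable (computable_bool_and
      (computable_nat_lt (Primrec.list_length.to_comp.comp hv) (Computable.const 3))
      (computable_nat_le Computable.snd (Computable.const 0)))).or
      ((hRs.mul_lt_mul ?_ ?_ hv hu).and ((hRs.mul_lt_mul ?_ ?_ hu hv).and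
        (CEIn.of_computable (computable_nat_le (Computable.const 3)
          (Primrec.list_length.to_comp.comp hv)))))
    · exact computable_nat_mul hk1 (Computable.const k)
    · exact computable_nat_mul hk2 (Computable.const (k + 1))
    · exact computable_nat_mul hk2 (Computable.const k)
    · exact computable_nat_mul hk1 (Computable.const (k + 1))
  have hk0 : (0 : ℝ) < k := Nat.cast_pos.2 hk
  set θ : ℝ := (k + 1) / k with hθ
  have hθ1 : 1 < θ := by rw [hθ, one_lt_div hk0]; linarith
  have hθ0 : 0 < θ := one_pos.trans hθ1
  have hposR : ∀ w : Str D, 2 ≤ w.length → ∀ a,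
      0 < prob R w ∧ 0 < prob R (w ++ [a]) := by
    intro w hw a
    have h := hpos w hw a
    unfold condProb at h
    have h1 := prob_nonneg R w
    have h2 := prob_nonneg R (w ++ [a])
    exact ⟨h1.lt_of_ne fun h0 => by simp [← h0] at h,
      h2.lt_of_ne fun h0 => by simp [← h0] at h⟩
  obtain ⟨f, hf, hfA⟩ := hA.exists_computable_selector (computable_oracleWindow_const c) <| by
    intro v
    by_cases h3 : v.length < 3
    · exact ⟨0, Or.inl (by simp [h3])⟩
    · obtain ⟨w, a, rfl⟩ : ∃ w a, v = w ++ [a] :=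
        ⟨v.dropLast, v.getLast (by rintro rfl; simp at h3), (List.dropLast_append_getLast _).symm⟩
      obtain ⟨h1, h2⟩ := hposR w (by simp at h3; omega) a
      obtain ⟨m, hm1, hm2⟩ := exists_nat_pow_near (x := prob R w / prob R (w ++ [a]))
        ((one_le_div h2).2 (prob_concat_le R w a)) hθ1
      refine ⟨m, Or.inr ⟨?_, ?_, decide_eq_true (not_lt.1 h3)⟩⟩ <;>
      push_cast <;> simp only [List.length_append, List.length_singleton, Nat.add_sub_cancel,
        List.take_left]
      · rw [le_div_iff₀ h2, hθ, div_pow, div_mul_eq_mul_div, div_le_iff₀ (by positivity)] at hm1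
        have : (0 : ℝ) < prob R w * k ^ m := by positivity
        nlinarith
      · rw [div_lt_iff₀ h2, hθ, div_pow, div_mul_eq_mul_div, lt_div_iff₀ (by positivity)] at hm2
        rw [pow_succ, pow_succ] at hm2
        linarith
  -- Adding one makes the integer code length positive, as needed for lower bounds on its
  -- conditional means, and raises the error from one unit to two.
  refine ⟨fun v => f v + 1, computable_nat_add hf (Computable.const 1), fun v => Nat.le_add_left 1 _, ?_, ?_⟩
  · intro v hv3
    rcases hfA v with h | h
    · simp at h; simp [h.2]
    · simp at h; omega
  · intro w hw a
    obtain ⟨h1, h2⟩ := hposR w hw a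
    rcases hfA (w ++ [a]) with h | h
    · simp at h; omega
    · simp only [List.length_append, List.length_singleton, Nat.add_sub_cancel, List.take_left] at h
      obtain ⟨h3, h4, -⟩ := h
      push_cast at h3 h4
      set m := f (w ++ [a])
      have hr : -Real.log (condProb R w a) = Real.log (prob R w / prob R (w ++ [a])) := by
        rw [condProb, ← Real.log_inv, inv_div]
      have hr0 : 0 < prob R w / prob R (w ++ [a]) := div_pos h1 h2
      have e1 : θ ^ m < prob R w / prob R (w ++ [a]) * θ := by
        rw [div_mul_eq_mul_div, lt_div_iff₀ h2, hθ, div_pow, div_mul_eq_mul_div, mul_div_assoc',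
          div_lt_div_iff₀ (by positivity) hk0]
        linarith
      have e2 : prob R w / prob R (w ++ [a]) < θ ^ m * θ := by
        rw [div_lt_iff₀ h2, hθ, div_pow, div_mul_div_comm, div_mul_eq_mul_div,
          lt_div_iff₀ (by positivity)]
        linarith
      have l1 := Real.log_lt_log (by positivity) e1
      have l2 := Real.log_lt_log hr0 e2
      rw [Real.log_mul hr0.ne' hθ0.ne', Real.log_pow] at l1
      rw [Real.log_mul (by positivity) hθ0.ne', Real.log_pow] at l2
      rw [hr, abs_le]
      push_cast
      constructor <;> nlinarith [Real.log_pos hθ1]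

end ProbCE

end AlgRandom

namespace AlgRandom

/-! ### An exponential inequality for martingale differences on words -/

section Azuma

/-- The linear term vanishes when a martingale difference is averaged, leaving only the Gaussian
factor. -/
theorem exp_le_add_exp_sq (x : ℝ) : Real.exp x ≤ x + Real.exp (x ^ 2) := by
  have h2 := Real.add_one_le_exp (x ^ 2)
  rcases le_or_gt |x| 1 with h | h
  · have := (abs_le.1 (Real.abs_exp_sub_one_sub_id_le h)).2
    linarith
  · rcases lt_abs.1 h with h1 | h1
    · have : Real.exp x ≤ Real.exp (x ^ 2) := Real.exp_le_exp.2 (by nlinarith)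
      linarith
    · have : Real.exp x ≤ 1 := Real.exp_le_one_iff.2 (by linarith)
      nlinarith

variable {D : ℕ} (P : Measure (Seq D))

theorem take_concat_of_le (w : Str D) (a : Fin D) {i : ℕ} (h : i ≤ w.length) :
    (w ++ [a]).take i = w.take i := by
  rw [List.take_append_of_le_length h]

theorem sum_take_concat (h : Str D → ℝ) (w : Str D) (a : Fin D) {n : ℕ} (hw : w.length = n) :
    ∑ i ∈ Finset.range (n + 1), h ((w ++ [a]).take (i + 1)) =
      ∑ i ∈ Finset.range n, h (w.take (i + 1)) + h (w ++ [a]) := by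
  rw [Finset.sum_range_succ, List.take_of_length_le (by simp [hw])]
  congr 1
  refine Finset.sum_congr rfl fun i hi => ?_
  rw [take_concat_of_le]
  have := Finset.mem_range.1 hi
  omega

theorem sum_words_succ (g : Str D → ℝ) (n : ℕ) :
    ∑ v : Fin (n + 1) → Fin D, g (List.ofFn v) =
      ∑ v : Fin n → Fin D, ∑ a, g (List.ofFn v ++ [a]) := by
  rw [← (Fin.snocEquiv fun _ : Fin (n + 1) => Fin D).sum_comp, Fintype.sum_prod_type,
    Finset.sum_comm]
  refine Finset.sum_congr rfl fun v _ => Finset.sum_congr rfl fun a _ => ?_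
  rw [List.ofFn_succ', List.concat_eq_append]
  simp [Fin.snocEquiv]

/-- Summing over the last letter bounds the exponential moment by a factor `exp (t² b_n²)` times the
previous one. The martingale property `h0` is stated with joint probabilities, so null words need no
exception. -/
theorem sum_prob_mul_exp_le [IsProbabilityMeasure P] {h : Str D → ℝ} {b : ℕ → ℝ}
    (hb : ∀ w a, |h (w ++ [a])| ≤ b w.length)
    (h0 : ∀ w, ∑ a, prob P (w ++ [a]) * h (w ++ [a]) = 0) (t : ℝ) (n : ℕ) :
    ∑ v : Fin n → Fin D, prob P (List.ofFn v) *
        Real.exp (t * ∑ i ∈ Finset.range n, h ((List.ofFn v).take (i + 1))) ≤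
      Real.exp (t ^ 2 * ∑ i ∈ Finset.range n, b i ^ 2) := by
  induction n with
  | zero => simp [prob_nil]
  | succ n ih =>
    rw [sum_words_succ (fun w => prob P w *
      Real.exp (t * ∑ i ∈ Finset.range (n + 1), h (w.take (i + 1))))]
    have step : ∀ w : Str D, w.length = n → ∑ a, prob P (w ++ [a]) *
        Real.exp (t * ∑ i ∈ Finset.range (n + 1), h ((w ++ [a]).take (i + 1))) ≤
        prob P w * Real.exp (t * ∑ i ∈ Finset.range n, h (w.take (i + 1))) *
          Real.exp (t ^ 2 * b n ^ 2) := by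
      intro w hw
      have e : ∀ a, prob P (w ++ [a]) * Real.exp (t * h (w ++ [a])) ≤
          t * (prob P (w ++ [a]) * h (w ++ [a])) +
            prob P (w ++ [a]) * Real.exp (t ^ 2 * b n ^ 2) := by
        intro a
        have h1 := exp_le_add_exp_sq (t * h (w ++ [a]))
        have h2 : Real.exp ((t * h (w ++ [a])) ^ 2) ≤ Real.exp (t ^ 2 * b n ^ 2) := by
          rw [Real.exp_le_exp, mul_pow, ← sq_abs (h _)]
          have := hb w a
          rw [hw] at this
          gcongr
        have h3 := prob_nonneg P (w ++ [a])
        nlinarith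
      have e' := Finset.sum_le_sum fun a (_ : a ∈ Finset.univ) => e a
      rw [Finset.sum_add_distrib, ← Finset.mul_sum, h0, ← Finset.sum_mul, sum_prob_concat,
        mul_zero, zero_add] at e'
      calc _ = (∑ a, prob P (w ++ [a]) * Real.exp (t * h (w ++ [a]))) *
            Real.exp (t * ∑ i ∈ Finset.range n, h (w.take (i + 1))) := by
            rw [Finset.sum_mul]
            refine Finset.sum_congr rfl fun a _ => ?_
            rw [sum_take_concat h w a hw, mul_add, Real.exp_add]
            ring
        _ ≤ _ := (mul_le_mul_of_nonneg_right e' (Real.exp_nonneg _)).trans_eq (by ring)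
    calc _ ≤ ∑ v : Fin n → Fin D, prob P (List.ofFn v) *
          Real.exp (t * ∑ i ∈ Finset.range n, h ((List.ofFn v).take (i + 1))) *
            Real.exp (t ^ 2 * b n ^ 2) :=
          Finset.sum_le_sum fun v _ => step _ (List.length_ofFn)
      _ ≤ Real.exp (t ^ 2 * ∑ i ∈ Finset.range n, b i ^ 2) * Real.exp (t ^ 2 * b n ^ 2) := by
          rw [← Finset.sum_mul]
          exact mul_le_mul_of_nonneg_right ih (Real.exp_nonneg _)
      _ = _ := by rw [← Real.exp_add, ← mul_add, Finset.sum_range_succ]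

open Classical in
theorem measureReal_word_le [IsProbabilityMeasure P] (E : Str D → Prop) (n : ℕ) :
    P.real {x | E (word x 1 n)} ≤
      ∑ v : Fin n → Fin D, if E (List.ofFn v) then prob P (List.ofFn v) else 0 := by
  rw [← Finset.sum_filter]
  refine (measureReal_mono ?_ (measure_ne_top _ _)).trans (measureReal_biUnion_finset_le _
    fun v : Fin n → Fin D => {x | word x 1 (List.ofFn v).length = List.ofFn v})
  intro x hx
  have hw : List.ofFn (fun i : Fin n => x (1 + (i : ℕ))) = word x 1 n := by
    apply List.ext_getElem <;> simp [word]
  simp only [Finset.mem_filter, Finset.mem_univ, true_and, Set.mem_iUnion, Set.mem_ofPred_eq,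
    List.length_ofFn, exists_prop]
  exact ⟨_, hw ▸ hx, hw.symm⟩

/-- An inequality of Azuma-Hoeffding type. -/
theorem measureReal_sum_gt_le [IsProbabilityMeasure P] {h : Str D → ℝ} {b : ℕ → ℝ}
    (hb : ∀ w a, |h (w ++ [a])| ≤ b w.length)
    (h0 : ∀ w, ∑ a, prob P (w ++ [a]) * h (w ++ [a]) = 0) {t : ℝ} (ht : 0 ≤ t) (r : ℝ) (n : ℕ) :
    P.real {x | r < ∑ i ∈ Finset.range n, h ((word x 1 n).take (i + 1))} ≤
      Real.exp (t ^ 2 * ∑ i ∈ Finset.range n, b i ^ 2 - t * r) := by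
  classical
  rw [Real.exp_sub, le_div_iff₀ (Real.exp_pos _)]
  refine le_trans ?_ (sum_prob_mul_exp_le P hb h0 t n)
  refine (mul_le_mul_of_nonneg_right (measureReal_word_le P
    (fun w => r < ∑ i ∈ Finset.range n, h (w.take (i + 1))) n) (Real.exp_nonneg _)).trans ?_
  rw [Finset.sum_mul]
  refine Finset.sum_le_sum fun v _ => ?_
  split_ifs with hv
  · exact mul_le_mul_of_nonneg_left (Real.exp_le_exp.2 (mul_le_mul_of_nonneg_left hv.le ht))
      (prob_nonneg P _)
  · rw [zero_mul]
    exact mul_nonneg (prob_nonneg P _) (Real.exp_nonneg _)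

theorem eventually_measureReal_sum_gt_le [IsProbabilityMeasure P] {h : Str D → ℝ} {b : ℕ → ℝ}
    (hb : ∀ w a, |h (w ++ [a])| ≤ b w.length)
    (h0 : ∀ w, ∑ a, prob P (w ++ [a]) * h (w ++ [a]) = 0)
    (hsum : ∀ᶠ n : ℕ in atTop,
      ∑ i ∈ Finset.range n, b i ^ 2 ≤ (n : ℝ) ^ 2 / (16 * Real.log n)) :
    ∀ᶠ n : ℕ in atTop, P.real {x | (n : ℝ) < ∑ i ∈ Finset.range n, h ((word x 1 n).take (i + 1))} ≤
      1 / (n * (n + 1)) := by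
  filter_upwards [hsum, eventually_ge_atTop 2] with n hn hn2
  have hn0 : (2 : ℝ) ≤ n := by exact_mod_cast hn2
  have hlog : 0 < Real.log n := Real.log_pos (by linarith)
  -- This `t` turns the exponent into at most `ln n - 4 ln n`, giving probability at most `n⁻³`.
  refine (measureReal_sum_gt_le P hb h0 (t := 4 * Real.log n / n) (by positivity) n n).trans ?_
  have e : (4 * Real.log n / n) ^ 2 * ∑ i ∈ Finset.range n, b i ^ 2 - 4 * Real.log n / n * n ≤
      -(3 * Real.log n) := by
    have := mul_le_mul_of_nonneg_left hn (sq_nonneg (4 * Real.log n / n))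
    have e1 : (4 * Real.log n / n) ^ 2 * ((n : ℝ) ^ 2 / (16 * Real.log n)) = Real.log n := by
      field_simp
      norm_num
    have e2 : 4 * Real.log n / n * n = 4 * Real.log n := by field_simp
    linarith
  refine (Real.exp_le_exp.2 e).trans ?_
  have e3 : Real.exp (3 * Real.log n) = (n : ℝ) ^ 3 := by
    rw [mul_comm, Real.exp_mul, Real.exp_log (by linarith)]
    norm_cast
  rw [Real.exp_neg, e3, one_div]
  exact inv_anti₀ (by positivity) (by nlinarith [mul_nonneg (show (0:ℝ) ≤ n - 2 by linarith) (sq_nonneg (n:ℝ))])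

end Azuma

/-! ### Tests -/

section Tests

variable {D : ℕ} {s : Seq D} {P : Measure (Seq D)} {x : Seq D}

/-- A uniformly computably enumerable family of sets of words defines a test, if the events have
small probabilities. -/
theorem IsRandomRel.exists_forall_not (hx : IsRandomRel s P x) {E : ℕ × Str D → Prop}
    (hE : CEIn s E) (hP : ∀ k, P.real {y | ∃ n, E (k, word y 1 n)} ≤ 2⁻¹ ^ k) :
    ∃ k, ∀ n, ¬E (k, word x 1 n) := by
  have hU : ∀ k, {y : Seq D | ∃ n, E (k, word y 1 n)} =
      {y | ∃ p ∈ {p : Str D × Str D | decide (p.1.length ≤ 0) = true ∧ E (k, p.2)},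
        y ∈ cylinder p.1 p.2} := by
    intro k
    ext y
    constructor
    · rintro ⟨n, h⟩
      exact ⟨([], word y 1 n), ⟨rfl, h⟩, by simp [cylinder_nil, length_word]⟩
    · rintro ⟨⟨σ, τ⟩, ⟨h1, h2⟩, h3⟩
      simp only [decide_eq_true_eq, Nat.le_zero, List.length_eq_zero_iff] at h1
      subst h1
      rw [cylinder_nil] at h3
      exact ⟨τ.length, by rw [h3]; exact h2⟩
  have hn := hx (fun k => {y | ∃ n, E (k, word y 1 n)}) ⟨⟨_, ?_, hU⟩, hP⟩
  · simp only [Set.mem_iInter, Set.mem_ofPred_eq, not_forall, not_exists] at hn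
    exact hn
  · exact (CEIn.of_computable (computable_nat_le (Primrec.list_length.to_comp.comp
      (Computable.fst.comp Computable.snd)) (Computable.const 0))).and
        (hE.comp (Computable.fst.pair (Computable.snd.comp Computable.snd)))

/-- There are `D^n` words of length `n`, so those of probability below `2^(-k) D^(-n)` have total
mass at most `2^(-k)`. This is a test in `k`, and a null word fails it at every level. -/
theorem prob_pos_of_isRandomRel [IsProbabilityMeasure P] (hP : ProbCE s P)
    (hx : IsRandomRel s P x) (n : ℕ) : 0 < prob P (word x 1 n) := by
  have hlen : Computable fun p : ℕ × Str D => p.2.length :=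
    Primrec.list_length.to_comp.comp Computable.snd
  have hE : CEIn s fun p : ℕ × Str D =>
      ((2 ^ p.1 * D ^ n : ℕ) : ℝ) * prob P p.2 < ((1 : ℕ) : ℝ) * prob P [] ∧
        (decide (p.2.length ≤ n) && decide (n ≤ p.2.length)) = true :=
    (hP.mul_lt_mul (computable_nat_mul (computable_nat_pow 2 Computable.fst)
      (Computable.const _)) (Computable.const 1) Computable.snd (Computable.const [])).and
      (CEIn.of_computable (computable_bool_and (computable_nat_le hlen (Computable.const n))
        (computable_nat_le (Computable.const n) hlen)))
  obtain ⟨k, hk⟩ := hx.exists_forall_not hE <| by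
    intro k
    have hsub : {y : Seq D | ∃ m, ((2 ^ k * D ^ n : ℕ) : ℝ) * prob P (word y 1 m) <
        ((1 : ℕ) : ℝ) * prob P [] ∧ (decide ((word y 1 m).length ≤ n) &&
          decide (n ≤ (word y 1 m).length)) = true} ⊆
        {y | ((2 ^ k * D ^ n : ℕ) : ℝ) * prob P (word y 1 n) < 1} := by
      rintro y ⟨m, h1, h2⟩
      simp only [length_word, Bool.and_eq_true, decide_eq_true_eq] at h2
      obtain rfl : m = n := by omega
      simpa [prob_nil] using h1
    refine (measureReal_mono hsub).trans ((measureReal_word_le P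
      (fun w => ((2 ^ k * D ^ n : ℕ) : ℝ) * prob P w < 1) n).trans ?_)
    have hx0 : 0 < D := (x 0).pos
    have hD : (0 : ℝ) < D := Nat.cast_pos.2 hx0
    refine (Finset.sum_le_card_nsmul _ _ (2⁻¹ ^ k / (D : ℝ) ^ n) fun v _ => ?_).trans_eq ?_
    · split_ifs with hv
      · push_cast at hv
        rw [le_div_iff₀ (by positivity), inv_pow, ← one_div, le_div_iff₀ (by positivity)]
        linarith
      · positivity
    · simp only [Finset.card_univ, Fintype.card_fun, Fintype.card_fin, nsmul_eq_mul]
      push_cast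
      field_simp
  by_contra hn
  have h0 : prob P (word x 1 n) = 0 := le_antisymm (not_lt.1 hn) (prob_nonneg P _)
  exact hk n (by simp [h0, length_word, prob_nil])

/-- The bounds telescope, since `1/(n(n+1)) = 1/n - 1/(n+1)`. -/
theorem measureReal_exists_ge_le [IsProbabilityMeasure P] {A : ℕ → Set (Seq D)} {N : ℕ}
    (hN : 0 < N) (hA : ∀ n, N ≤ n → P.real (A n) ≤ 1 / (n * (n + 1))) :
    P.real {y | ∃ n, N ≤ n ∧ y ∈ A n} ≤ 1 / N := by
  have hfin : ∀ M, N ≤ M → P.real (⋃ n ∈ Finset.Ico N M, A n) ≤ 1 / N - 1 / M := by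
    intro M hM
    induction M, hM using Nat.le_induction with
    | base => simp
    | succ M hM ih =>
      have hM0 : (0 : ℝ) < M := Nat.cast_pos.2 (hN.trans_le hM)
      rw [Nat.Ico_succ_right_eq_insert_Ico hM, Finset.set_biUnion_insert, Set.union_comm]
      refine (measureReal_union_le _ _).trans ((add_le_add ih (hA M hM)).trans_eq ?_)
      push_cast
      field_simp
      ring
  have hmono : Monotone fun M : ℕ => ⋃ n ∈ Finset.Ico N M, A n := by
    intro M M' h
    exact Set.biUnion_mono (Finset.Ico_subset_Ico le_rfl h) fun _ _ => subset_rfl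
  have hset : {y | ∃ n, N ≤ n ∧ y ∈ A n} = ⋃ M : ℕ, ⋃ n ∈ Finset.Ico N M, A n := by
    ext y
    simp only [Set.mem_ofPred_eq, Set.mem_iUnion, Finset.mem_Ico, exists_prop]
    exact ⟨fun ⟨n, h1, h2⟩ => ⟨n + 1, n, ⟨h1, n.lt_succ_self⟩, h2⟩,
      fun ⟨_, n, ⟨h1, _⟩, h2⟩ => ⟨n, h1, h2⟩⟩
  rw [hset]
  have hlim : Tendsto (fun M : ℕ => P.real (⋃ n ∈ Finset.Ico N M, A n)) atTop
      (𝓝 (P.real (⋃ M : ℕ, ⋃ n ∈ Finset.Ico N M, A n))) :=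
    (ENNReal.tendsto_toReal (measure_ne_top _ _)).comp (tendsto_measure_iUnion_atTop hmono)
  refine le_of_tendsto hlim (eventually_atTop.2 ⟨N, fun M hM => (hfin M hM).trans ?_⟩)
  have : (0 : ℝ) ≤ 1 / M := by positivity
  linarith

/-- An effective Borel-Cantelli lemma. -/
theorem IsRandomRel.eventually_not [IsProbabilityMeasure P] (hx : IsRandomRel s P x)
    {E : Str D → Prop} (hE : CEIn s E)
    (hP : ∀ᶠ n : ℕ in atTop, P.real {y | E (word y 1 n)} ≤ 1 / (n * (n + 1))) :
    ∀ᶠ n in atTop, ¬E (word x 1 n) := by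
  obtain ⟨N, hN⟩ := eventually_atTop.1 hP
  -- Level `k` of the test looks only at lengths from `N + 2^k` on, where the tail has mass at most
  -- `2^(-k)`.
  have hpow : Computable fun p : ℕ × Str D => N + 2 ^ p.1 :=
    computable_nat_add (Computable.const N) (computable_nat_pow 2 Computable.fst)
  have hE' : CEIn s fun p : ℕ × Str D => decide (N + 2 ^ p.1 ≤ p.2.length) = true ∧ E p.2 :=
    (CEIn.of_computable (computable_nat_le hpow
      (Primrec.list_length.to_comp.comp Computable.snd))).and (hE.comp Computable.snd)
  obtain ⟨k, hk⟩ := hx.exists_forall_not hE' <| by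
    intro k
    simp only [decide_eq_true_eq, length_word]
    refine (measureReal_exists_ge_le (A := fun n => {y | E (word y 1 n)}) (by positivity)
      fun n hn => hN n ((Nat.le_add_right _ _).trans hn)).trans ?_
    rw [inv_pow, ← one_div]
    refine one_div_le_one_div_of_le (by positivity) ?_
    push_cast
    linarith [(Nat.cast_nonneg N : (0 : ℝ) ≤ N)]
  refine eventually_atTop.2 ⟨N + 2 ^ k, fun n hn h => hk n ⟨?_, h⟩⟩
  simpa [length_word] using hn

end Tests

end AlgRandom

namespace AlgRandom

/-! ### An effective law of large numbers -/

section LawOfLargeNumbers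

variable {D : ℕ} {s : Seq D} {P : Measure (Seq D)} {x : Seq D}

/-- The conditional expectation of `f (X_1^{n+1})` given `X_1^n = w`. -/
noncomputable def condMean (P : Measure (Seq D)) (f : Str D → ℝ) (w : Str D) : ℝ :=
  ∑ a, condProb P w a * f (w ++ [a])

theorem sum_mul_prob_concat [IsProbabilityMeasure P] (f : Str D → ℝ) (w : Str D) :
    ∑ a, f (w ++ [a]) * prob P (w ++ [a]) = prob P w * condMean P f w := by
  rw [condMean, Finset.mul_sum]
  refine Finset.sum_congr rfl fun a _ => ?_
  rw [← prob_mul_condProb]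
  ring

theorem condMean_nonneg {f : Str D → ℝ} {w : Str D} (hf : ∀ a, 0 ≤ f (w ++ [a])) :
    0 ≤ condMean P f w :=
  Finset.sum_nonneg fun a _ => mul_nonneg (condProb_nonneg P w a) (hf a)

theorem condMean_le [IsProbabilityMeasure P] {f : Str D → ℝ} {w : Str D} {b : ℝ} (hb : 0 ≤ b)
    (hf : ∀ a, f (w ++ [a]) ≤ b) : condMean P f w ≤ b := by
  refine (Finset.sum_le_sum fun a _ =>
    mul_le_mul_of_nonneg_left (hf a) (condProb_nonneg P w a)).trans ?_
  rw [← Finset.sum_mul]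
  exact mul_le_of_le_one_left hb (sum_condProb_le P w)

theorem le_condMean [IsProbabilityMeasure P] {f : Str D → ℝ} {w : Str D} {b : ℝ}
    (hw : 0 < prob P w) (hf : ∀ a, b ≤ f (w ++ [a])) : b ≤ condMean P f w := by
  refine le_trans ?_ (Finset.sum_le_sum fun a _ =>
    mul_le_mul_of_nonneg_left (hf a) (condProb_nonneg P w a))
  rw [← Finset.sum_mul, sum_condProb P hw, one_mul]

theorem abs_sub_condMean_le [IsProbabilityMeasure P] {f : Str D → ℝ} {b : ℕ → ℝ}
    (hf0 : ∀ v, 0 ≤ f v) (hfb : ∀ w a, f (w ++ [a]) ≤ b w.length) (w : Str D) (a : Fin D) :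
    |f (w ++ [a]) - condMean P f w| ≤ b w.length := by
  have hb := (hf0 _).trans (hfb w a)
  have h1 : 0 ≤ condMean P f w := condMean_nonneg fun a => hf0 _
  have h2 : condMean P f w ≤ b w.length := condMean_le hb (hfb w)
  rw [abs_le]
  constructor <;> linarith [hf0 (w ++ [a]), hfb w a]

theorem sum_prob_mul_sub_condMean [IsProbabilityMeasure P] (f : Str D → ℝ) (w : Str D) :
    ∑ a, prob P (w ++ [a]) * (f (w ++ [a]) - condMean P f w) = 0 := by
  simp only [mul_sub, Finset.sum_sub_distrib, ← Finset.sum_mul, sum_prob_concat]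
  rw [← sum_mul_prob_concat, sub_eq_zero]
  exact Finset.sum_congr rfl fun a _ => mul_comm _ _

theorem sum_take_word_sub (f : Str D → ℝ) (g : Str D → ℝ) (y : Seq D) (n : ℕ) :
    ∑ i ∈ Finset.range n, (f ((word y 1 n).take (i + 1)) -
        g ((word y 1 n).take (i + 1)).dropLast) =
      ∑ i ∈ Finset.range n, f (word y 1 (i + 1)) - ∑ i ∈ Finset.range n, g (word y 1 i) := by
  rw [← Finset.sum_sub_distrib]
  refine Finset.sum_congr rfl fun i hi => ?_
  have := Finset.mem_range.1 hi
  rw [take_word _ _ (by omega), word_succ, List.dropLast_concat]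

/-- The exponential inequality is applied to `f` minus its conditional mean and to the negative of
this difference. The mean is taken at `v.dropLast`, which makes each difference a function of a
single prefix. -/
theorem eventually_measureReal_condMean_le [IsProbabilityMeasure P] {f : Str D → ℝ} {b : ℕ → ℝ}
    (hf0 : ∀ v, 0 ≤ f v) (hfb : ∀ w a, f (w ++ [a]) ≤ b w.length)
    (hsum : ∀ᶠ n : ℕ in atTop,
      ∑ i ∈ Finset.range n, b i ^ 2 ≤ (n : ℝ) ^ 2 / (16 * Real.log n)) :
    (∀ᶠ n : ℕ in atTop, P.real {y | ∑ i ∈ Finset.range n, condMean P f (word y 1 i) + n <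
        ∑ i ∈ Finset.range n, f (word y 1 (i + 1))} ≤ 1 / (n * (n + 1))) ∧
    ∀ᶠ n : ℕ in atTop, P.real {y | ∑ i ∈ Finset.range n, f (word y 1 (i + 1)) + n <
        ∑ i ∈ Finset.range n, condMean P f (word y 1 i)} ≤ 1 / (n * (n + 1)) := by
  have h1 := eventually_measureReal_sum_gt_le P (h := fun v => f v - condMean P f v.dropLast)
    (b := b) (by simpa using abs_sub_condMean_le hf0 hfb)
    (by simpa using sum_prob_mul_sub_condMean f) hsum
  have h2 := eventually_measureReal_sum_gt_le P (h := fun v => -f v - -condMean P f v.dropLast)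
    (b := b) (fun w a => by
      rw [← neg_sub', abs_neg]
      simpa using abs_sub_condMean_le hf0 hfb w a)
    (fun w => by
      have := sum_prob_mul_sub_condMean (P := P) f w
      simp only [← neg_sub', mul_neg, Finset.sum_neg_distrib, List.dropLast_concat, this, neg_zero])
    hsum
  constructor
  · filter_upwards [h1] with n hn
    refine le_trans (le_of_eq ?_) hn
    congr 1
    ext y
    simp only [Set.mem_ofPred_eq, sum_take_word_sub f (condMean P f)]
    constructor <;> intro h <;> linarith
  · filter_upwards [h2] with n hn
    refine le_trans (le_of_eq ?_) hn
    congr 1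
    ext y
    simp only [Set.mem_ofPred_eq, sum_take_word_sub (fun v => -f v) (fun v => -condMean P f v),
      Finset.sum_neg_distrib]
    constructor <;> intro h <;> linarith

theorem computable_sum_take {α : Type} [Primcodable α] {f : Str D → ℕ} (hf : Computable f)
    {w : α → Str D} (hw : Computable w) :
    Computable fun p => ∑ i ∈ Finset.range (w p).length, f ((w p).take (i + 1)) :=
  computable_sum_range (g := fun p : α × ℕ => f ((w p.1).take (p.2 + 1)))
    (Primrec.list_length.to_comp.comp hw)
    (hf.comp (Primrec.list_take.to_comp.comp (Computable.succ.comp Computable.snd)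
      (hw.comp Computable.fst)))

theorem computable_sum_getD {α : Type} [Primcodable α] {n : α → ℕ} (hn : Computable n)
    {q : α → List ℕ} (hq : Computable q) :
    Computable fun p => ∑ i ∈ Finset.range (n p), (q p).getD i 0 :=
  computable_sum_range (g := fun p : α × ℕ => (q p.1).getD p.2 0) hn
    ((Primrec.list_getD 0).to_comp.comp (hq.comp Computable.fst) Computable.snd)

theorem CEIn.forall_take {A : Str D × ℕ → Prop} (hA : CEIn s A) :
    CEIn s fun p : Str D × List ℕ => ∀ i < p.1.length, A (p.1.take i, p.2.getD i 0) :=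
  CEIn.forall_lt (A := fun p : (Str D × List ℕ) × ℕ => A (p.1.1.take p.2, p.1.2.getD p.2 0))
    (hA.comp ((Primrec.list_take.to_comp.comp Computable.snd
      (Computable.fst.comp Computable.fst)).pair
        ((Primrec.list_getD 0).to_comp.comp (Computable.snd.comp Computable.fst) Computable.snd)))
    (Primrec.list_length.to_comp.comp Computable.fst)

theorem sum_getD_map_range (q : ℕ → ℕ) (n : ℕ) :
    ∑ i ∈ Finset.range n, ((List.range n).map q).getD i 0 = ∑ i ∈ Finset.range n, q i := by
  refine Finset.sum_congr rfl fun i hi => ?_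
  simp [List.getD, Finset.mem_range.1 hi]

/-- The deviation event is replaced by an enumerable subevent: some list `q` of integers strictly
dominates the conditional means, and even `∑ q + n` is below the sum of `f`. Outside it, rounding
the means up by at most one each costs a second `n`. -/
theorem IsRandomRel.eventually_sum_le [IsProbabilityMeasure P] (hP : ProbCE s P)
    (hx : IsRandomRel s P x) {f : Str D → ℕ} (hf : Computable f)
    (hsmall : ∀ᶠ n : ℕ in atTop,
      P.real {y | ∑ i ∈ Finset.range n, condMean P (fun v => f v) (word y 1 i) + n <
        ∑ i ∈ Finset.range n, (f (word y 1 (i + 1)) : ℝ)} ≤ 1 / (n * (n + 1))) :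
    ∀ᶠ n : ℕ in atTop, ∑ i ∈ Finset.range n, (f (word x 1 (i + 1)) : ℝ) ≤
      ∑ i ∈ Finset.range n, condMean P (fun v => f v) (word x 1 i) + 2 * n := by
  have hlen : Computable fun p : Str D × List ℕ => p.1.length :=
    Primrec.list_length.to_comp.comp Computable.fst
  have hE := ((hP.sum_concat_lt hf).forall_take.and (CEIn.of_computable (computable_nat_lt
    (computable_nat_add (computable_sum_getD hlen Computable.snd) hlen)
    (computable_sum_take hf Computable.fst)))).exists
  have hpos := prob_pos_of_isRandomRel hP hx
  refine (hx.eventually_not hE ?_).mono fun n hn => ?_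
  swap
  · set q : ℕ → ℕ := fun i => ⌊condMean P (fun v => f v) (word x 1 i)⌋₊ + 1 with hq
    have hn' := not_exists.1 hn ((List.range n).map q)
    simp only [length_word, decide_eq_true_eq, sum_getD_map_range, not_and] at hn'
    have hle := hn' fun i hi => by
      rw [take_word _ _ hi.le, sum_mul_prob_concat fun v => (f v : ℝ), mul_comm]
      refine mul_lt_mul_of_pos_right ?_ (hpos i)
      simpa [List.getD, hi, hq] using Nat.lt_floor_add_one _
    rw [not_lt, ← Nat.cast_le (α := ℝ)] at hle
    push_cast at hle
    have e1 : ∑ i ∈ Finset.range n, (f ((word x 1 n).take (i + 1)) : ℝ) =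
        ∑ i ∈ Finset.range n, (f (word x 1 (i + 1)) : ℝ) :=
      Finset.sum_congr rfl fun i hi => by
        rw [take_word _ _ (Nat.succ_le_of_lt (Finset.mem_range.1 hi))]
    have e2 : ∑ i ∈ Finset.range n, (q i : ℝ) ≤
        ∑ i ∈ Finset.range n, (condMean P (fun v => (f v : ℝ)) (word x 1 i) + 1) := by
      refine Finset.sum_le_sum fun i _ => ?_
      simp only [hq]
      push_cast
      have := Nat.floor_le (condMean_nonneg (P := P) (f := fun v => (f v : ℝ)) (w := word x 1 i)
        fun a => Nat.cast_nonneg _)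
      linarith
    rw [Finset.sum_add_distrib] at e2
    simp only [Finset.sum_const, Finset.card_range, nsmul_eq_mul, mul_one] at e2
    rw [e1] at hle
    linarith
  · filter_upwards [hsmall] with n hn
    refine (measureReal_mono ?_ (measure_ne_top _ _)).trans hn
    rintro y ⟨q, h1, h2⟩
    simp only [length_word, decide_eq_true_eq] at h1 h2
    rw [← Nat.cast_lt (α := ℝ)] at h2
    push_cast at h2
    have e1 : ∑ i ∈ Finset.range n, (f ((word y 1 n).take (i + 1)) : ℝ) =
        ∑ i ∈ Finset.range n, (f (word y 1 (i + 1)) : ℝ) :=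
      Finset.sum_congr rfl fun i hi => by
        rw [take_word _ _ (Nat.succ_le_of_lt (Finset.mem_range.1 hi))]
    have e2 : ∑ i ∈ Finset.range n, condMean P (fun v => (f v : ℝ)) (word y 1 i) ≤
        ∑ i ∈ Finset.range n, ((q.getD i 0 : ℕ) : ℝ) := by
      refine Finset.sum_le_sum fun i hi => ?_
      have h3 := h1 i (Finset.mem_range.1 hi)
      rw [take_word _ _ (Finset.mem_range.1 hi).le, sum_mul_prob_concat fun v => (f v : ℝ),
        mul_comm] at h3
      exact (lt_of_mul_lt_mul_right h3 (prob_nonneg P _)).le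
    rw [e1] at h2
    exact lt_of_le_of_lt (by gcongr) h2

theorem IsRandomRel.eventually_sum_ge [IsProbabilityMeasure P] (hP : ProbCE s P)
    (hx : IsRandomRel s P x) {f : Str D → ℕ} (hf : Computable f) (hf1 : ∀ v, 1 ≤ f v)
    (hsmall : ∀ᶠ n : ℕ in atTop,
      P.real {y | ∑ i ∈ Finset.range n, (f (word y 1 (i + 1)) : ℝ) + n <
        ∑ i ∈ Finset.range n, condMean P (fun v => f v) (word y 1 i)} ≤ 1 / (n * (n + 1))) :
    ∀ᶠ n : ℕ in atTop, ∑ i ∈ Finset.range n, condMean P (fun v => f v) (word x 1 i) ≤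
      ∑ i ∈ Finset.range n, (f (word x 1 (i + 1)) : ℝ) + 2 * n := by
  have hlen : Computable fun p : Str D × List ℕ => p.1.length :=
    Primrec.list_length.to_comp.comp Computable.fst
  have hE := ((hP.lt_sum_concat hf).forall_take.and (CEIn.of_computable (computable_nat_lt
    (computable_nat_add (computable_sum_take hf Computable.fst) hlen)
    (computable_sum_getD hlen Computable.snd)))).exists
  have hpos := prob_pos_of_isRandomRel hP hx
  refine (hx.eventually_not hE ?_).mono fun n hn => ?_
  swap
  -- An integer strictly below the mean and within one of it. The assumption `1 ≤ f` keeps the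
  -- ceiling positive; for mean zero the truncated subtraction would give no strict bound.
  · set q : ℕ → ℕ := fun i => ⌈condMean P (fun v => f v) (word x 1 i)⌉₊ - 1 with hq
    have hone : ∀ i, 1 ≤ condMean P (fun v => (f v : ℝ)) (word x 1 i) := fun i =>
      le_condMean (hpos i) fun a => by exact_mod_cast hf1 _
    have hceil : ∀ i, 1 ≤ ⌈condMean P (fun v => (f v : ℝ)) (word x 1 i)⌉₊ := fun i =>
      Nat.one_le_ceil_iff.2 (one_pos.trans_le (hone i))
    have hn' := not_exists.1 hn ((List.range n).map q)
    simp only [length_word, decide_eq_true_eq, sum_getD_map_range, not_and] at hn'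
    have hle := hn' fun i hi => by
      rw [take_word _ _ hi.le, sum_mul_prob_concat fun v => (f v : ℝ), mul_comm (prob P _)]
      refine mul_lt_mul_of_pos_right ?_ (hpos i)
      have h1 : q i < ⌈condMean P (fun v => (f v : ℝ)) (word x 1 i)⌉₊ :=
        Nat.sub_one_lt_of_le (hceil i) le_rfl
      simpa [List.getD, hi] using Nat.lt_ceil.1 h1
    rw [not_lt, ← Nat.cast_le (α := ℝ)] at hle
    push_cast at hle
    have e1 : ∑ i ∈ Finset.range n, (f ((word x 1 n).take (i + 1)) : ℝ) =
        ∑ i ∈ Finset.range n, (f (word x 1 (i + 1)) : ℝ) :=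
      Finset.sum_congr rfl fun i hi => by
        rw [take_word _ _ (Nat.succ_le_of_lt (Finset.mem_range.1 hi))]
    have e2 : ∑ i ∈ Finset.range n, (condMean P (fun v => (f v : ℝ)) (word x 1 i) - 1) ≤
        ∑ i ∈ Finset.range n, (q i : ℝ) := by
      refine Finset.sum_le_sum fun i _ => ?_
      simp only [hq]
      rw [Nat.cast_sub (hceil i)]
      push_cast
      linarith [Nat.le_ceil (condMean P (fun v => (f v : ℝ)) (word x 1 i))]
    rw [Finset.sum_sub_distrib] at e2
    simp only [Finset.sum_const, Finset.card_range, nsmul_eq_mul, mul_one] at e2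
    rw [e1] at hle
    linarith
  · filter_upwards [hsmall] with n hn
    refine (measureReal_mono ?_ (measure_ne_top _ _)).trans hn
    rintro y ⟨q, h1, h2⟩
    simp only [length_word, decide_eq_true_eq] at h1 h2
    rw [← Nat.cast_lt (α := ℝ)] at h2
    push_cast at h2
    have e1 : ∑ i ∈ Finset.range n, (f ((word y 1 n).take (i + 1)) : ℝ) =
        ∑ i ∈ Finset.range n, (f (word y 1 (i + 1)) : ℝ) :=
      Finset.sum_congr rfl fun i hi => by
        rw [take_word _ _ (Nat.succ_le_of_lt (Finset.mem_range.1 hi))]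
    have e2 : ∑ i ∈ Finset.range n, ((q.getD i 0 : ℕ) : ℝ) ≤
        ∑ i ∈ Finset.range n, condMean P (fun v => (f v : ℝ)) (word y 1 i) := by
      refine Finset.sum_le_sum fun i hi => ?_
      have h3 := h1 i (Finset.mem_range.1 hi)
      rw [take_word _ _ (Finset.mem_range.1 hi).le, sum_mul_prob_concat fun v => (f v : ℝ),
        mul_comm (prob P _)] at h3
      exact (lt_of_mul_lt_mul_right h3 (prob_nonneg P _)).le
    rw [e1] at h2
    exact h2.trans_le e2

/-- Along a random point, the sums of a computable function of the growing words stay close to the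
sums of its conditional means. -/
theorem IsRandomRel.eventually_abs_sum_sub_le [IsProbabilityMeasure P] (hP : ProbCE s P)
    (hx : IsRandomRel s P x) {f : Str D → ℕ} (hf : Computable f) (hf1 : ∀ v, 1 ≤ f v)
    {b : ℕ → ℝ} (hfb : ∀ w a, (f (w ++ [a]) : ℝ) ≤ b w.length)
    (hsum : ∀ᶠ n : ℕ in atTop,
      ∑ i ∈ Finset.range n, b i ^ 2 ≤ (n : ℝ) ^ 2 / (16 * Real.log n)) :
    ∀ᶠ n : ℕ in atTop, |∑ i ∈ Finset.range n,
      ((f (word x 1 (i + 1)) : ℝ) - condMean P (fun v => f v) (word x 1 i))| ≤ 2 * n := by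
  obtain ⟨h1, h2⟩ := eventually_measureReal_condMean_le (P := P) (f := fun v => (f v : ℝ))
    (fun v => Nat.cast_nonneg _) hfb hsum
  filter_upwards [hx.eventually_sum_le hP hf h1, hx.eventually_sum_ge hP hf hf1 h2] with n h3 h4
  rw [Finset.sum_sub_distrib, abs_le]
  constructor <;> linarith

end LawOfLargeNumbers

/-! ### Growth of the bounds -/

section Growth

theorem tendsto_log_div_self : Tendsto (fun n : ℕ => Real.log n / n) atTop (𝓝 0) := by
  have := (Real.tendsto_pow_log_div_mul_add_atTop 1 0 1 one_ne_zero).comp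
    tendsto_natCast_atTop_atTop
  simpa [Function.comp_def] using this

theorem div_log_le_div_log {m n : ℕ} (hm : 3 ≤ m) (hmn : m ≤ n) :
    (m : ℝ) / Real.log m ≤ n / Real.log n := by
  have he : Real.exp 1 ≤ m := by
    have : (3 : ℝ) ≤ m := by exact_mod_cast hm
    linarith [Real.exp_one_lt_d9]
  have hmn' : (m : ℝ) ≤ n := by exact_mod_cast hmn
  have h := Real.log_div_self_antitoneOn (Set.mem_ofPred_eq ▸ he)
    (Set.mem_ofPred_eq ▸ he.trans hmn') hmn'
  have hn : (1 : ℝ) < n := by linarith [Real.add_one_lt_exp one_ne_zero]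
  have := inv_anti₀ (div_pos (Real.log_pos hn) (by linarith)) h
  rwa [inv_div, inv_div] at this

/-- Each square is `o(i/ln i)`, and `i/ln i` increases from 3 on, so the tail is at most `n` times a
small multiple of `n/ln n`. The fixed initial sum is absorbed because `n²/ln n ≥ n`. Each of the two
pieces takes a share of `1/32`, half of `1/16`. -/
theorem eventually_sum_sq_le {ε : ℕ → ℝ} (hε : Tendsto ε atTop (𝓝 0)) (A : ℝ) :
    ∀ᶠ n : ℕ in atTop, ∑ i ∈ Finset.range n,
      (A * |ε i| * Real.sqrt ((i : ℝ) / Real.log i) + 2) ^ 2 ≤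
        (n : ℝ) ^ 2 / (16 * Real.log n) := by
  set b : ℕ → ℝ := fun i => A * |ε i| * Real.sqrt ((i : ℝ) / Real.log i) + 2 with hb
  have hlim : Tendsto (fun i : ℕ => (A * |ε i| + 2 * Real.sqrt (Real.log i / i)) ^ 2)
      atTop (𝓝 0) := by
    have h1 := (hε.abs.const_mul A).add ((tendsto_log_div_self.sqrt).const_mul 2)
    simpa using h1.pow 2
  have hterm : ∀ᶠ i : ℕ in atTop, b i ^ 2 ≤ 1 / 32 * ((i : ℝ) / Real.log i) := by
    filter_upwards [hlim.eventually_le_const (show (0 : ℝ) < 1 / 32 by norm_num),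
      eventually_ge_atTop 3] with i hi hi3
    have hi1 : (1 : ℝ) < i := by exact_mod_cast (by omega : 1 < i)
    have hu : 0 < (i : ℝ) / Real.log i := div_pos (by linarith) (Real.log_pos hi1)
    have hbi : b i = Real.sqrt ((i : ℝ) / Real.log i) *
        (A * |ε i| + 2 * Real.sqrt (Real.log i / i)) := by
      have : Real.sqrt ((i : ℝ) / Real.log i) * Real.sqrt (Real.log i / i) = 1 := by
        rw [← Real.sqrt_mul hu.le, div_mul_div_cancel₀ (Real.log_pos hi1).ne',
          div_self (by linarith), Real.sqrt_one]
      simp only [hb]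
      linear_combination (-2) * this
    rw [hbi, mul_pow, Real.sq_sqrt hu.le, mul_comm]
    exact mul_le_mul_of_nonneg_right hi hu.le
  obtain ⟨N, hN⟩ := eventually_atTop.1 (hterm.and (eventually_ge_atTop 3))
  set C := ∑ i ∈ Finset.range N, b i ^ 2 with hC
  have hCn : ∀ᶠ n : ℕ in atTop, 32 * C ≤ n :=
    tendsto_natCast_atTop_atTop.eventually_ge_atTop (32 * C)
  filter_upwards [hCn, eventually_ge_atTop N, eventually_ge_atTop 3] with n h1 h2 h3
  have hn1 : (1 : ℝ) < n := by exact_mod_cast (by omega : 1 < n)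
  have hlog : 0 < Real.log n := Real.log_pos hn1
  have hlogle : Real.log n ≤ n := (Real.log_le_sub_one_of_pos (by linarith)).trans (by linarith)
  have e1 : C ≤ 1 / 32 * ((n : ℝ) ^ 2 / Real.log n) := by
    have : (n : ℝ) ≤ (n : ℝ) ^ 2 / Real.log n := by
      rw [le_div_iff₀ hlog]
      nlinarith
    linarith
  have e2 : ∑ i ∈ Finset.Ico N n, b i ^ 2 ≤ 1 / 32 * ((n : ℝ) ^ 2 / Real.log n) := by
    have : ∀ i ∈ Finset.Ico N n, b i ^ 2 ≤ 1 / 32 * (n / Real.log n) := by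
      intro i hi
      obtain ⟨hi1, hi2⟩ := Finset.mem_Ico.1 hi
      obtain ⟨h4, h5⟩ := hN i hi1
      exact h4.trans (mul_le_mul_of_nonneg_left (div_log_le_div_log h5 hi2.le) (by norm_num))
    refine (Finset.sum_le_card_nsmul _ _ _ this).trans ?_
    rw [nsmul_eq_mul, Nat.card_Ico]
    have hcard : ((n - N : ℕ) : ℝ) ≤ n := by exact_mod_cast Nat.sub_le _ _
    refine (mul_le_mul_of_nonneg_right hcard (by positivity)).trans_eq ?_
    ring
  rw [← Finset.sum_range_add_sum_Ico _ h2]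
  refine (add_le_add e1 e2).trans_eq ?_
  field_simp
  norm_num

end Growth

/-! ### Conditional universality -/

section Universality

variable {D : ℕ} {s : Seq D} {P R : Measure (Seq D)} {x : Seq D}

theorem neg_log_prob_word [IsProbabilityMeasure R] (hpos : ∀ n, 0 < prob R (word x 1 n)) (n : ℕ) :
    -Real.log (prob R (word x 1 n)) =
      ∑ i ∈ Finset.range n, -Real.log (condProb R (word x 1 i) (x (1 + i))) := by
  induction n with
  | zero => simp [word, prob_nil]
  | succ n ih =>
    rw [Finset.sum_range_succ, ← ih, condProb, ← word_succ,
      Real.log_div (hpos _).ne' (hpos _).ne']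
    ring

/-- In units of `c = log (1 + 1/k) ≤ 1/k`, the law of large numbers costs `2n`, rounding of code
lengths and of their means `4n`, and the two initial indices at most `n` for large `n`. Hence the
constant 7. -/
theorem eventually_abs_codeLength_sub_le [IsProbabilityMeasure P] (hR : ComputableMeasure R)
    {ε : ℕ → ℝ} (hε : Tendsto ε atTop (𝓝 0))
    (hbound : ∀ n : ℕ, 2 ≤ n → ∀ w : Str D, w.length = n → ∀ a : Fin D,
      0 < condProb R w a ∧
      -Real.logb 2 (condProb R w a) ≤ ε n * Real.sqrt ((n : ℝ) / Real.log (n : ℝ)))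
    (hP : ProbCE s P) (hx : IsRandomRel s P x) {k : ℕ} (hk : 0 < k) :
    ∀ᶠ n : ℕ in atTop, |∑ i ∈ Finset.range n, (-Real.log (condProb R (word x 1 i) (x (1 + i))) -
      ∑ a, condProb P (word x 1 i) a * -Real.log (condProb R (word x 1 i) a))| ≤ 7 / k * n := by
  obtain ⟨f, hf, hf1, hf3, hfR⟩ := exists_computable_codeLength hR (x 0)
    (fun w hw a => (hbound _ hw w rfl a).1) hk
  have hk0 : (0 : ℝ) < k := Nat.cast_pos.2 hk
  set c := Real.log (((k : ℝ) + 1) / k) with hc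
  have hc0 : 0 < c := Real.log_pos (by rw [one_lt_div hk0]; linarith)
  have hck : c ≤ 1 / k := by
    refine (Real.log_le_sub_one_of_pos (by positivity)).trans_eq ?_
    field_simp
    ring
  have hlog2 : 0 < Real.log 2 := Real.log_pos one_lt_two
  -- The factor `log 2 / c` converts bits into units of `c`; the summand 2 covers the rounding error
  -- and the default code length of short words.
  have hlln := hx.eventually_abs_sum_sub_le hP hf hf1
    (b := fun i => Real.log 2 / c * |ε i| * Real.sqrt ((i : ℝ) / Real.log i) + 2) ?_
    (eventually_sum_sq_le hε _)
  · set ℓ : Str D → Fin D → ℝ := fun w a => -Real.log (condProb R w a) with hℓ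
    set d : ℕ → ℝ := fun i => (ℓ (word x 1 i) (x (1 + i)) - f (word x 1 (i + 1)) * c) -
      (∑ a, condProb P (word x 1 i) a * ℓ (word x 1 i) a -
        condMean P (fun v => f v) (word x 1 i) * c) with hd
    have hd4 : ∀ i, 2 ≤ i → |d i| ≤ 4 * c := by
      intro i hi
      have hlen : 2 ≤ (word x 1 i).length := by rwa [length_word]
      have h1 := hfR _ hlen (x (1 + i))
      have h2 : |∑ a, condProb P (word x 1 i) a * ℓ (word x 1 i) a -
          condMean P (fun v => f v) (word x 1 i) * c| ≤ 2 * c := by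
        rw [condMean, Finset.sum_mul, ← Finset.sum_sub_distrib]
        refine (Finset.abs_sum_le_sum_abs _ _).trans ?_
        have : ∀ a ∈ Finset.univ, |condProb P (word x 1 i) a * ℓ (word x 1 i) a -
            condProb P (word x 1 i) a * f (word x 1 i ++ [a]) * c| ≤
            condProb P (word x 1 i) a * (2 * c) := by
          intro a _
          rw [mul_assoc, ← mul_sub, abs_mul, abs_of_nonneg (condProb_nonneg P _ _)]
          exact mul_le_mul_of_nonneg_left (hfR _ hlen a) (condProb_nonneg P _ _)
        refine (Finset.sum_le_sum this).trans ?_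
        rw [← Finset.sum_mul]
        exact mul_le_of_le_one_left (by positivity) (sum_condProb_le P _)
      rw [← word_succ] at h1
      refine (abs_sub _ _).trans ?_
      linarith
    have hsumd : ∀ n : ℕ, |∑ i ∈ Finset.range n, d i| ≤ |d 0| + |d 1| + 4 * c * n := by
      intro n
      refine (Finset.abs_sum_le_sum_abs _ _).trans ?_
      -- Code lengths are controlled only from index 2 on; the first two discrepancies are constants
      -- in `n`.
      have h1 : ∀ i ∈ Finset.range n, |d i| ≤ (if i = 0 then |d 0| else 0) +
          (if i = 1 then |d 1| else 0) + 4 * c := by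
        intro i _
        rcases i with _ | _ | i
        · simp [hc0.le]
        · simp [hc0.le]
        · simpa using hd4 (i + 2) (by omega)
      refine (Finset.sum_le_sum h1).trans ?_
      rw [Finset.sum_add_distrib, Finset.sum_add_distrib, Finset.sum_ite_eq', Finset.sum_ite_eq']
      simp only [Finset.sum_const, Finset.card_range, nsmul_eq_mul]
      have h2 : (if 0 ∈ Finset.range n then |d 0| else 0) ≤ |d 0| := by split_ifs <;> simp
      have h3 : (if 1 ∈ Finset.range n then |d 1| else 0) ≤ |d 1| := by split_ifs <;> simp
      linarith
    have hlarge : ∀ᶠ n : ℕ in atTop, (|d 0| + |d 1|) / c ≤ n :=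
      tendsto_natCast_atTop_atTop.eventually_ge_atTop _
    filter_upwards [hlln, hlarge] with n h1 h2
    rw [div_le_iff₀ hc0] at h2
    have e : ∑ i ∈ Finset.range n, (ℓ (word x 1 i) (x (1 + i)) -
        ∑ a, condProb P (word x 1 i) a * ℓ (word x 1 i) a) = ∑ i ∈ Finset.range n, d i +
        (∑ i ∈ Finset.range n,
          ((f (word x 1 (i + 1)) : ℝ) - condMean P (fun v => f v) (word x 1 i))) * c := by
      rw [Finset.sum_mul, ← Finset.sum_add_distrib]
      refine Finset.sum_congr rfl fun i _ => ?_
      simp only [hd]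
      ring
    rw [e]
    refine (abs_add_le _ _).trans ?_
    rw [abs_mul, abs_of_pos hc0]
    have h3 := mul_le_mul_of_nonneg_right h1 hc0.le
    have h4 := mul_le_mul_of_nonneg_right hck (Nat.cast_nonneg (α := ℝ) n)
    have h5 : (7 : ℝ) / k * n = 7 * (1 / k * n) := by ring
    rw [h5]
    linarith [hsumd n]
  · intro w a
    have hnn : 0 ≤ Real.log 2 / c * |ε w.length| *
        Real.sqrt ((w.length : ℝ) / Real.log w.length) := by positivity
    rcases lt_or_ge w.length 2 with hw | hw
    · rw [hf3 _ (by simp; omega)]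
      push_cast
      linarith
    · have h1 := (abs_le.1 (hfR w hw a)).1
      have h2 := (hbound _ hw w rfl a).2
      rw [Real.logb, ← neg_div, div_le_iff₀ hlog2] at h2
      have h3 : ε w.length * Real.sqrt ((w.length : ℝ) / Real.log w.length) * Real.log 2 ≤
          |ε w.length| * Real.sqrt ((w.length : ℝ) / Real.log w.length) * Real.log 2 := by
        gcongr
        exact le_abs_self _
      refine le_of_mul_le_mul_right ?_ hc0
      have h4 : (Real.log 2 / c * |ε w.length| *
          Real.sqrt ((w.length : ℝ) / Real.log w.length) + 2) * c =
          |ε w.length| * Real.sqrt ((w.length : ℝ) / Real.log w.length) * Real.log 2 + 2 * c := by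
        field_simp
      rw [h4]
      linarith

end Universality

end AlgRandom

/-! ### Passage to the limit. -/

theorem mainTheorem10 (D : ℕ) (hD : 2 ≤ D)
    (R : Measure (AlgRandom.Seq D)) (hR : AlgRandom.IsOneUniversal R)
    (ε : ℕ → ℝ) (hε : Tendsto ε atTop (𝓝 0))
    (hbound : ∀ n : ℕ, 2 ≤ n → ∀ w : AlgRandom.Str D, w.length = n → ∀ a : Fin D,
      0 < AlgRandom.condProb R w a ∧
      -Real.logb 2 (AlgRandom.condProb R w a) ≤ ε n * Real.sqrt ((n : ℝ) / Real.log (n : ℝ)))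
    (P : Measure (AlgRandom.Seq D)) (hP : AlgRandom.IsStationaryErgodic P)
    (x : AlgRandom.Seq D) (hx : AlgRandom.IsMartinLofRandom P x) :
    (∀ n : ℕ, 0 < AlgRandom.prob P (AlgRandom.word x 1 n)) ∧
    Tendsto
      (fun n : ℕ => (∑ i ∈ Finset.range n,
        -∑ a : Fin D, AlgRandom.condProb P (AlgRandom.word x 1 i) a *
          Real.logb 2 (AlgRandom.condProb R (AlgRandom.word x 1 i) a)) / (n : ℝ))
      atTop (𝓝 (AlgRandom.entropyRate P)) := by
  obtain ⟨hRpos, hRlim⟩ := hR.2 P hP x hx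
  have := hP.1
  have := hR.1.1
  obtain ⟨s, hs, hxs⟩ := hx
  refine ⟨AlgRandom.prob_pos_of_isRandomRel hs.probCE hxs, ?_⟩
  set δ : ℕ → ℝ := fun n => (∑ i ∈ Finset.range n,
    (-Real.log (AlgRandom.condProb R (AlgRandom.word x 1 i) (x (1 + i))) -
      ∑ a, AlgRandom.condProb P (AlgRandom.word x 1 i) a *
        -Real.log (AlgRandom.condProb R (AlgRandom.word x 1 i) a))) / n with hδ
  have hδlim : Tendsto δ atTop (𝓝 0) := by
    rw [Metric.tendsto_atTop']
    intro r hr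
    -- The resolution `k` is chosen after the tolerance `r`. The test depends on `k`, but `x` passes
    -- all `(s, P)`-tests for the same `s`.
    obtain ⟨k, hk⟩ := exists_nat_gt (7 / r)
    have hk0 : (0 : ℝ) < k := (by positivity : (0 : ℝ) < 7 / r).trans hk
    obtain ⟨N, hN⟩ := eventually_atTop.1 (AlgRandom.eventually_abs_codeLength_sub_le hR.1 hε
      hbound hs.probCE hxs (Nat.cast_pos.1 hk0))
    refine ⟨N, fun n hn => ?_⟩
    have hn0 : (0 : ℝ) < n := Nat.cast_pos.2 (by omega)
    rw [Real.dist_eq, sub_zero, hδ, abs_div, abs_of_pos hn0, div_lt_iff₀ hn0]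
    refine (hN n hn.le).trans_lt (mul_lt_mul_of_pos_right ?_ hn0)
    rw [div_lt_iff₀ hk0]
    rw [div_lt_iff₀ hr] at hk
    linarith
  -- Subtracting the vanishing discrepancy, converted to bits, from the averaged code length along
  -- `x` leaves exactly the averaged conditional means.
  have hlim := hRlim.sub (hδlim.div_const (Real.log 2))
  rw [zero_div, sub_zero] at hlim
  refine hlim.congr fun n => ?_
  have h1 : -Real.logb 2 (AlgRandom.prob R (AlgRandom.word x 1 n)) =
      -Real.log (AlgRandom.prob R (AlgRandom.word x 1 n)) / Real.log 2 := by
    rw [Real.logb, neg_div]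
  rw [h1, AlgRandom.neg_log_prob_word hRpos, hδ, div_right_comm, ← sub_div, ← sub_div,
    Finset.sum_sub_distrib, sub_sub_cancel, div_right_comm, Finset.sum_div]
  congr 1
  refine Finset.sum_congr rfl fun i _ => ?_
  simp only [Real.logb, mul_neg, Finset.sum_neg_distrib, neg_div, Finset.sum_div, mul_div_assoc]
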